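/- Theorem 2.1. Let $g>0$, $\rho_+>\rho_->0$, $\mu_\pm>0$ and $B\in\mathbb R$ (the magnetic field is vertical, $\bar B=(0,B)$). Put $[\rho]=\rho_+-\rho_-$, let $\rho(x)=\rho_+,\ \mu(x)=\mu_+$ for $x>0$ and $\rho(x)=\rho_-,\ \mu(x)=\mu_-$ for $x<0$, and write $\llbracket f\rrbracket=f(0^+)-f(0^-)$. For $\xi\in\mathbb R$ consider the normal-mode problem for a function $\psi:[-1,1]\to\mathbb R$ and a number $\lambda>0$: $\psi$ is four times continuously differentiable on $(-1,0)$ and on $(0,1)$, where it satisfies $$-\lambda^2\rho(|\xi|^2\psi-\psi'')=\mu\lambda(|\xi|^4\psi-2|\xi|^2\psi''+\psi'''')+|B|^2(-|\xi|^2\psi''+\psi''''),$$ together with the jump conditions at $0$ (all one-sided limits existing, and $\psi(0)$ being the common limit of $\psi$) $$\llbracket\psi\rrbracket=\llbracket\psi'\rrbracket=0,\qquad \llbracket\mu\lambda(|\xi|^2\psi+\psi'')+|B|^2\psi''\rrbracket=0,$$ $$\llbracket\mu\lambda(\psi'''-3|\xi|^2\psi')+|B|^2\psi'''\rrbracket=\llbracket\lambda^2\rho\psi'\rrbracket+g[\rho]|\xi|^2\psi(0),$$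 and the boundary conditions $\psi(\pm1)=\psi'(\pm1)=0$, where $\psi$ and $\psi'$ take these values continuously from inside $(-1,1)$. Define $|B|_c\ge0$ by $$|B|_c^2=\sup_{0\ne\psi\in H_0^1((-1,1))}\frac{g[\rho]\psi(0)^2}{\int_{-1}^1|\psi'|^2\,dx},$$ and, if $|B|<|B|_c$, define $|\xi|_{vc}^B\ge0$ by $$(|\xi|_{vc}^B)^2=\inf\frac{|B|^2\int_{-1}^1|\psi''|^2\,dx}{g[\rho]\psi(0)^2-|B|^2\int_{-1}^1|\psi'|^2\,dx},$$ the infimum being over all $\psi\in H_0^2((-1,1))$ for which the denominator is positive. Then: (i) If $|B|\ge|B|_c$, then for every $\xi\in\mathbb R$ the problem has no solution $(\psi,\lambda)$ with $\lambda>0$ and $\psi\not\equiv0$. (ii) If $|B|<|B|_c$, then for every $\xi\in\mathbb R$ with $|\xi|\le|\xi|_{vc}^B$ the problem has no solution $(\psi,\lambda)$ with $\lambda>0$ and $\psi\not\equiv0$. (iii) If $|B|<|B|_c$, then for every $\xi\in\mathbb R$ with $|\xi|>|\xi|_{vc}^B$ there is a solution $\psi=\psi(\xi,\cdot)$, $\lambda=\lambda(\xi)>0$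 of the problem, and these can be chosen such that $\psi(-\xi,\cdot)=\psi(\xi,\cdot)$ and $\lambda(-\xi)=\lambda(\xi)$, the function $\psi(\xi,\cdot)$ is smooth on $(-1,0)$ and on $(0,1)$, and $\psi(\xi,0)\ne0$. -/

import Mathlib

open Set Filter Topology MeasureTheory
open scoped ContDiff

/-- `ψ ∈ H¹₀((-1,1))` with weak derivative `ψ'`. The function `ψ` is the continuous representative
on `[-1,1]`, it vanishes at the end points, and `ψ' ∈ L²((-1,1))`. -/
structure IsH10 (ψ ψ' : ℝ → ℝ) : Prop where
  continuousOn : ContinuousOn ψ (Icc (-1) 1)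
  memLp_deriv : MemLp ψ' 2 (volume.restrict (Ioo (-1) 1))
  weak_deriv : ∀ φ : ℝ → ℝ, ContDiff ℝ ∞ φ → HasCompactSupport φ → tsupport φ ⊆ Ioo (-1) 1 →
    ∫ x in Ioo (-1 : ℝ) 1, ψ x * deriv φ x = -∫ x in Ioo (-1 : ℝ) 1, ψ' x * φ x
  left_eq_zero : ψ (-1) = 0
  right_eq_zero : ψ 1 = 0

/-- `ψ ∈ H²₀((-1,1))`, i.e. `ψ ∈ H²` and `ψ(±1) = ψ'(±1) = 0`, with first and second weak
derivatives `ψ'` (continuous representative) and `ψ''`. -/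
structure IsH20 (ψ ψ' ψ'' : ℝ → ℝ) : Prop where
  fst : IsH10 ψ ψ'
  snd : IsH10 ψ' ψ''

/-- The critical magnetic number: `|B|_c² = sup g[ρ]ψ(0)² / ∫ |ψ'|²` over nonzero `ψ ∈ H¹₀((-1,1))`,
where `[ρ] = ρp - ρm`. -/
noncomputable def criticalMagneticNumber (g ρp ρm : ℝ) : ℝ :=
  √(sSup {r : ℝ | ∃ ψ ψ' : ℝ → ℝ, IsH10 ψ ψ' ∧ 0 < ∫ x in Ioo (-1 : ℝ) 1, ψ' x ^ 2 ∧
    r = g * (ρp - ρm) * ψ 0 ^ 2 / ∫ x in Ioo (-1 : ℝ) 1, ψ' x ^ 2})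

/-- The critical frequency for the vertical magnetic field:
`(|ξ|_vc^B)² = inf |B|² ∫ |ψ''|² / (g[ρ]ψ(0)² - |B|² ∫ |ψ'|²)` over the `ψ ∈ H²₀((-1,1))`
for which the denominator is positive. -/
noncomputable def verticalCriticalFrequency (g ρp ρm B : ℝ) : ℝ :=
  √(sInf {r : ℝ | ∃ ψ ψ' ψ'' : ℝ → ℝ, IsH20 ψ ψ' ψ'' ∧
    0 < g * (ρp - ρm) * ψ 0 ^ 2 - |B| ^ 2 * ∫ x in Ioo (-1 : ℝ) 1, ψ' x ^ 2 ∧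
    r = (|B| ^ 2 * ∫ x in Ioo (-1 : ℝ) 1, ψ'' x ^ 2) /
      (g * (ρp - ρm) * ψ 0 ^ 2 - |B| ^ 2 * ∫ x in Ioo (-1 : ℝ) 1, ψ' x ^ 2)})

/-- The coefficient equal to `ap` in the upper fluid and to `am` in the lower fluid. -/
noncomputable def twoPhase (ap am : ℝ) (x : ℝ) : ℝ := if 0 < x then ap else am

/-- `f` has one-sided limits at `0`, and its jump `f(0+) - f(0-)` equals `j`. -/
def HasJump (f : ℝ → ℝ) (j : ℝ) : Prop :=
  ∃ fp fm : ℝ, Tendsto f (𝓝[>] 0) (𝓝 fp) ∧ Tendsto f (𝓝[<] 0) (𝓝 fm) ∧ fp - fm = j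

/-- `ψ` (on `[-1,1]`) and `lam` solve the fourth-order normal-mode problem at frequency `ξ`
for the vertical magnetic field of strength `B`, densities `ρp, ρm` and viscosities `μp, μm`
(upper, lower fluid). Only the values of `ψ` on `[-1,1]` matter. -/
structure IsNormalMode (g ρp ρm μp μm B ξ : ℝ) (ψ : ℝ → ℝ) (lam : ℝ) : Prop where
  contDiffOn_lower : ContDiffOn ℝ 4 ψ (Ioo (-1) 0)
  contDiffOn_upper : ContDiffOn ℝ 4 ψ (Ioo 0 1)
  ode : ∀ x ∈ Ioo (-1 : ℝ) 0 ∪ Ioo 0 1,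
    -(lam ^ 2 * twoPhase ρp ρm x * (|ξ| ^ 2 * ψ x - iteratedDeriv 2 ψ x)) =
      twoPhase μp μm x * lam *
        (|ξ| ^ 4 * ψ x - 2 * |ξ| ^ 2 * iteratedDeriv 2 ψ x + iteratedDeriv 4 ψ x) +
      |B| ^ 2 * (-(|ξ| ^ 2 * iteratedDeriv 2 ψ x) + iteratedDeriv 4 ψ x)
  /-- `⟦ψ⟧ = 0`, with the common trace being the value `ψ 0`. -/
  continuousAt_zero : ContinuousAt ψ 0
  jump_deriv : HasJump (deriv ψ) 0
  jump_second : HasJump (fun x =>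
    twoPhase μp μm x * lam * (|ξ| ^ 2 * ψ x + iteratedDeriv 2 ψ x) +
      |B| ^ 2 * iteratedDeriv 2 ψ x) 0
  jump_third : ∃ j : ℝ, HasJump (fun x => lam ^ 2 * twoPhase ρp ρm x * deriv ψ x) j ∧
    HasJump (fun x =>
      twoPhase μp μm x * lam * (iteratedDeriv 3 ψ x - 3 * |ξ| ^ 2 * deriv ψ x) +
        |B| ^ 2 * iteratedDeriv 3 ψ x) (j + g * (ρp - ρm) * |ξ| ^ 2 * ψ 0)
  left_eq_zero : ψ (-1) = 0
  right_eq_zero : ψ 1 = 0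
  left_tendsto : Tendsto ψ (𝓝[>] (-1)) (𝓝 0)
  right_tendsto : Tendsto ψ (𝓝[<] 1) (𝓝 0)
  left_deriv_tendsto : Tendsto (deriv ψ) (𝓝[>] (-1)) (𝓝 0)
  right_deriv_tendsto : Tendsto (deriv ψ) (𝓝[<] 1) (𝓝 0)

/-! The equation together with the stress jumps is the strong form of the weak problem `E_λ(ψ,φ) =
g[ρ]ξ²ψ(0)φ(0)` for all `φ ∈ H²₀`. On the diagonal `E_λ = λ²P + λQ + R`, with kinetic, viscous and
magnetic parts `P, Q, R ≥ 0` and `R(ψ) = B²(ξ²∫|ψ'|² + ∫|ψ''|²)` (`IsTransmission.energyForm_eq`).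

Stability. Testing with `ψ` itself gives `g[ρ]ξ²ψ(0)² ≥ λ²ρ₋∫|ψ'|² + R(ψ)`. In cases (i) and (ii)
the variational definitions of the critical numbers say that `g[ρ]ξ²ψ(0)² ≤ R(ψ)`, so `ψ' = 0` and
`ψ = 0` (`IsTransmission.glueState_eq_zero`).

Instability. The eigenvalue problem is nonlinear in `λ`, but its source is concentrated at one
point. For each `λ > 0` let `w_λ` solve `E_λ(w_λ,φ) = φ(0)`; it exists because the problem is
finite-dimensional linear algebra with an energy uniqueness argument (`exists_isTransmission_one`).
Put `m(λ) = w_λ(0)`. Then `w_λ` is a mode as soon as `g[ρ]ξ² m(λ) = 1`. By Cauchy-Schwarz `m(λ)` is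
the maximum of `φ(0)²/E_λ(φ,φ)`, so `m` decreases while `λ²m(λ)` increases, and these two
monotonicities force continuity. A test function with `R(φ) < g[ρ]ξ²φ(0)²` makes `g[ρ]ξ² m > 1` for
small `λ`, and `m(λ) ≤ 1/(2ρ₋λ²)` makes it `< 1` for large `λ`; the intermediate value theorem
yields the growth rate (`exists_isTransmission_of_magnetic_lt`).

If `|ξ|` exceeds the critical frequency, the infimum defining it supplies such a `φ`, provided that
the infimum runs over a nonempty set. This follows from `|B|_c² ≤ g[ρ]/2` (the trace inequality
`IsH10.two_mul_sq_le`) and from smoothed tent functions (`exists_isH20_tension_lt`). -/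

/-! ### Functions with zero weak derivative -/

/-- A test function on `(-1,1)` with vanishing integral is the derivative of a test function. -/
theorem exists_deriv_eq_of_integral_eq_zero {k : ℝ → ℝ} (hk : ContDiff ℝ ∞ k)
    (hkc : HasCompactSupport k) (hks : tsupport k ⊆ Ioo (-1) 1)
    (hk0 : ∫ x in (-1 : ℝ)..1, k x = 0) :
    ∃ φ : ℝ → ℝ, ContDiff ℝ ∞ φ ∧ HasCompactSupport φ ∧ tsupport φ ⊆ Ioo (-1) 1 ∧
      deriv φ = k := by
  have hcont : Continuous k := hk.continuous
  obtain ⟨a, b, ha, hb, hsub⟩ : ∃ a b : ℝ, -1 < a ∧ b < 1 ∧ tsupport k ⊆ Icc a b := by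
    rcases (tsupport k).eq_empty_or_nonempty with h | h
    · exact ⟨0, 0, by norm_num, by norm_num, by simp [h]⟩
    · obtain ⟨a, ha, ha'⟩ := hkc.isCompact.exists_isLeast h
      obtain ⟨b, hb, hb'⟩ := hkc.isCompact.exists_isGreatest h
      exact ⟨a, b, (hks ha).1, (hks hb).2, fun x hx => ⟨ha' hx, hb' hx⟩⟩
  have hzero : ∀ x, x ∉ Icc a b → k x = 0 := fun x hx =>
    image_eq_zero_of_notMem_tsupport fun h => hx (hsub h)
  set φ : ℝ → ℝ := fun x => ∫ t in (-1 : ℝ)..x, k t with hφ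
  have hd : ∀ x, HasDerivAt φ (k x) x := fun x =>
    intervalIntegral.integral_hasDerivAt_right (hcont.intervalIntegrable _ _)
      hcont.stronglyMeasurable.stronglyMeasurableAtFilter hcont.continuousAt
  have hderiv : deriv φ = k := funext fun x => (hd x).deriv
  have hleft : ∀ x, x < a → φ x = 0 := by
    intro x hx
    refine (intervalIntegral.integral_congr (g := fun _ => (0 : ℝ)) ?_).trans (by simp)
    intro t ht
    refine hzero t fun h => ?_
    have : t ≤ max (-1) x := ht.2
    have : max (-1) x < a := max_lt ha hx
    linarith [h.1]
  have hright : ∀ x, b < x → φ x = 0 := by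
    intro x hx
    have h1 : φ x = (∫ t in (-1 : ℝ)..1, k t) + ∫ t in (1 : ℝ)..x, k t :=
      (intervalIntegral.integral_add_adjacent_intervals (hcont.intervalIntegrable _ _)
        (hcont.intervalIntegrable _ _)).symm
    rw [h1, hk0, zero_add]
    refine (intervalIntegral.integral_congr (g := fun _ => (0 : ℝ)) ?_).trans (by simp)
    intro t ht
    refine hzero t fun h => ?_
    have : min 1 x ≤ t := ht.1
    have : b < min 1 x := lt_min hb hx
    linarith [h.2]
  have hts : tsupport φ ⊆ Icc a b := by
    refine closure_minimal (fun x hx => ?_) isClosed_Icc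
    by_contra h
    rw [mem_Icc, not_and_or, not_le, not_le] at h
    exact hx (h.elim (hleft x) (hright x))
  refine ⟨φ, ?_, ?_, fun x hx => ⟨ha.trans_le (hts hx).1, (hts hx).2.trans_lt hb⟩, hderiv⟩
  · rw [contDiff_infty_iff_deriv, hderiv]
    exact ⟨fun x => (hd x).differentiableAt, hk⟩
  · exact HasCompactSupport.of_support_subset_isCompact isCompact_Icc
      ((subset_tsupport _).trans hts)

/-- Du Bois-Reymond: a continuous function on `[-1,1]` with zero weak derivative is constant. -/
theorem exists_eqOn_const_of_integral_mul_deriv_eq_zero {h : ℝ → ℝ}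
    (hc : ContinuousOn h (Icc (-1) 1))
    (hw : ∀ φ : ℝ → ℝ, ContDiff ℝ ∞ φ → HasCompactSupport φ → tsupport φ ⊆ Ioo (-1) 1 →
      ∫ x in (-1 : ℝ)..1, h x * deriv φ x = 0) :
    ∃ C : ℝ, ∀ x ∈ Icc (-1 : ℝ) 1, h x = C := by
  have huIcc : uIcc (-1 : ℝ) 1 = Icc (-1) 1 := uIcc_of_le (by norm_num)
  let bump : ContDiffBump (0 : ℝ) := ⟨1 / 4, 1 / 2, by norm_num, by norm_num⟩
  set θ : ℝ → ℝ := bump.normed volume with hθ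
  have hθs : ContDiff ℝ ∞ θ := bump.contDiff_normed
  have hθc : HasCompactSupport θ := bump.hasCompactSupport_normed
  have hθt : tsupport θ ⊆ Ioo (-1) 1 := by
    rw [hθ, bump.tsupport_normed_eq, Real.closedBall_eq_Icc]
    have hr : bump.rOut = 1 / 2 := rfl
    rw [hr]
    exact Icc_subset_Ioo (by norm_num) (by norm_num)
  have hint : ∀ k : ℝ → ℝ, tsupport k ⊆ Ioo (-1) 1 → ∫ x in (-1 : ℝ)..1, k x = ∫ x, k x :=
    fun k hk => intervalIntegral.integral_eq_integral_of_support_subset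
      ((subset_tsupport k).trans (hk.trans Ioo_subset_Ioc_self))
  have hθ1 : ∫ x in (-1 : ℝ)..1, θ x = 1 := by
    rw [hint θ hθt]; exact bump.integral_normed
  have hii : ∀ k : ℝ → ℝ, Continuous k →
      IntervalIntegrable (fun x => h x * k x) volume (-1) 1 := fun k hk =>
    ContinuousOn.intervalIntegrable (by rw [huIcc]; exact hc.mul hk.continuousOn)
  set C : ℝ := ∫ x in (-1 : ℝ)..1, h x * θ x with hC
  refine ⟨C, ?_⟩
  have hae : ∀ᵐ x, x ∈ Ioo (-1 : ℝ) 1 → h x - C = 0 := by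
    refine isOpen_Ioo.ae_eq_zero_of_integral_contDiff_smul_eq_zero ?_ ?_
    · exact ((hc.mono Ioo_subset_Icc_self).sub continuousOn_const).locallyIntegrableOn
        measurableSet_Ioo
    · intro g hg hgc hgt
      set c : ℝ := ∫ x in (-1 : ℝ)..1, g x with hcdef
      -- Subtracting the mean of `g` times the unit bump `θ` leaves a test function of zero
      -- integral, hence a derivative. Testing with it shows that `h` has the same pairing with `g`
      -- as the constant `C = ∫ h θ`.
      obtain ⟨φ, hφ, hφc, hφt, hφd⟩ := exists_deriv_eq_of_integral_eq_zero
        (k := g - fun x => c * θ x) (hg.sub (contDiff_const.mul hθs))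
        (hgc.sub hθc.mul_left)
        ((tsupport_sub _ _).trans (union_subset hgt ((tsupport_mul_subset_right).trans hθt))) (by
          simp only [Pi.sub_apply]
          rw [intervalIntegral.integral_sub (hg.continuous.intervalIntegrable _ _)
            ((hθs.continuous.intervalIntegrable _ _).const_mul c),
            intervalIntegral.integral_const_mul, hθ1]
          simp [hcdef])
      have h0 := hw φ hφ hφc hφt
      rw [hφd] at h0
      have h1 : ∫ x in (-1 : ℝ)..1, h x * (g - fun x => c * θ x) x
          = (∫ x in (-1 : ℝ)..1, h x * g x) - c * C := by
        rw [hC, ← intervalIntegral.integral_const_mul, ← intervalIntegral.integral_sub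
          (hii g hg.continuous) ((hii θ hθs.continuous).const_mul c)]
        refine intervalIntegral.integral_congr fun x _ => ?_
        simp only [Pi.sub_apply]; ring
      have h2 : ∫ x, g x • (h x - C) = ∫ x in (-1 : ℝ)..1, g x • (h x - C) := by
        refine (hint _ ?_).symm
        exact (tsupport_mul_subset_left).trans hgt
      rw [h2]
      have h3 : ∫ x in (-1 : ℝ)..1, g x • (h x - C)
          = (∫ x in (-1 : ℝ)..1, h x * g x) - C * c := by
        rw [hcdef, ← intervalIntegral.integral_const_mul, ← intervalIntegral.integral_sub
          (hii g hg.continuous) ((hg.continuous.intervalIntegrable _ _).const_mul C)]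
        refine intervalIntegral.integral_congr fun x _ => ?_
        simp only [smul_eq_mul]; ring
      rw [h3]; linarith
  refine Measure.eqOn_Icc_of_ae_eq (μ := volume) (by norm_num) ?_ hc continuousOn_const
  rw [← restrict_Ioo_eq_restrict_Icc]
  rw [EventuallyEq, ae_restrict_iff' measurableSet_Ioo]
  filter_upwards [hae] with x hx hx'
  linarith [hx hx']

/-! ### Primitives, integration by parts and the trace inequality in `H¹₀` -/

namespace IsH10

variable {f f' : ℝ → ℝ}

theorem intervalIntegrable_deriv (hf : IsH10 f f') : IntervalIntegrable f' volume (-1) 1 := by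
  rw [intervalIntegrable_iff_integrableOn_Ioo_of_le (by norm_num)]
  exact hf.memLp_deriv.integrable (by norm_num)

theorem memLp (hf : IsH10 f f') : MemLp f 2 (volume.restrict (Ioo (-1) 1)) := by
  obtain ⟨C, hC⟩ := isCompact_Icc.exists_bound_of_continuousOn hf.continuousOn
  refine MemLp.of_bound ((hf.continuousOn.mono Ioo_subset_Icc_self).aestronglyMeasurable
    measurableSet_Ioo) C ?_
  exact (ae_restrict_mem measurableSet_Ioo).mono fun x hx => hC x (Ioo_subset_Icc_self hx)

theorem absolutelyContinuous_primitive (hf : IsH10 f f') :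
    AbsolutelyContinuousOnInterval (fun x => ∫ t in (-1 : ℝ)..x, f' t) (-1) 1 :=
  hf.intervalIntegrable_deriv.absolutelyContinuousOnInterval_intervalIntegral (by simp)

theorem ae_deriv_primitive (hf : IsH10 f f') : ∀ᵐ x, x ∈ Icc (-1 : ℝ) 1 →
    deriv (fun x => ∫ t in (-1 : ℝ)..x, f' t) x = f' x := by
  filter_upwards [hf.intervalIntegrable_deriv.ae_hasDerivAt_integral] with x hx hx'
  rw [uIcc_of_le (by norm_num)] at hx
  exact (hx hx' (-1) (by norm_num)).deriv

/-- An `H¹₀` function is the primitive of its weak derivative. -/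
theorem eq_integral (hf : IsH10 f f') {x : ℝ} (hx : x ∈ Icc (-1 : ℝ) 1) :
    f x = ∫ t in (-1 : ℝ)..x, f' t := by
  have huIcc : uIcc (-1 : ℝ) 1 = Icc (-1) 1 := uIcc_of_le (by norm_num)
  have hac := hf.absolutelyContinuous_primitive
  set F : ℝ → ℝ := fun x => ∫ t in (-1 : ℝ)..x, f' t with hF
  have hFc : ContinuousOn F (Icc (-1) 1) := huIcc ▸ hac.continuousOn
  -- `f` and `F` have the same weak derivative, so they differ by a constant, which is zero because
  -- both vanish at `-1`.
  obtain ⟨C, hC⟩ := exists_eqOn_const_of_integral_mul_deriv_eq_zero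
      (h := fun x => f x - F x) (hf.continuousOn.sub hFc) (by
    intro φ hφ hφc hφt
    have hdc : Continuous (deriv φ) := hφ.continuous_deriv (by simp)
    have hφ1 : AbsolutelyContinuousOnInterval φ (-1) 1 :=
      (hφ.of_le (by exact_mod_cast le_top)).contDiffOn.absolutelyContinuousOnInterval
    have h1 := hac.integral_mul_deriv_eq_deriv_mul hφ1
    have e1 : φ 1 = 0 := image_eq_zero_of_notMem_tsupport fun h => by simpa using (hφt h).2
    have e2 : φ (-1) = 0 := image_eq_zero_of_notMem_tsupport fun h => by simpa using (hφt h).1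
    rw [e1, e2] at h1
    have h2 : ∫ x in (-1 : ℝ)..1, deriv F x * φ x = ∫ x in (-1 : ℝ)..1, f' x * φ x := by
      refine intervalIntegral.integral_congr_ae ?_
      filter_upwards [hf.ae_deriv_primitive] with x hx hx'
      rw [hx (huIcc ▸ uIoc_subset_uIcc hx')]
    have h3 := hf.weak_deriv φ hφ hφc hφt
    rw [← integral_Ioc_eq_integral_Ioo, ← integral_Ioc_eq_integral_Ioo,
      ← intervalIntegral.integral_of_le (by norm_num),
      ← intervalIntegral.integral_of_le (by norm_num)] at h3
    simp only [sub_mul]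
    rw [intervalIntegral.integral_sub, h3, h1, h2]
    · ring
    · exact ContinuousOn.intervalIntegrable
        (by rw [huIcc]; exact hf.continuousOn.mul hdc.continuousOn)
    · exact ContinuousOn.intervalIntegrable (by rw [huIcc]; exact hFc.mul hdc.continuousOn))
  have h0 := hC (-1) (by norm_num)
  have hF0 : F (-1) = 0 := by simp [hF]
  rw [hf.left_eq_zero, hF0] at h0
  linarith [hC x hx]

theorem intervalIntegrable_deriv_of_le (hf : IsH10 f f') {a b : ℝ} (ha : -1 ≤ a) (hab : a ≤ b)
    (hb : b ≤ 1) : IntervalIntegrable f' volume a b :=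
  hf.intervalIntegrable_deriv.mono_set (by
    rw [uIcc_of_le hab, uIcc_of_le (by norm_num)]; exact Icc_subset_Icc ha hb)

/-- Integration by parts of an `H¹₀` function against a `C¹` function. -/
theorem integral_deriv_mul_add (hf : IsH10 f f') {w w' : ℝ → ℝ}
    (hw : ∀ x, HasDerivAt w (w' x) x) (hw' : Continuous w') {a b : ℝ} (ha : -1 ≤ a)
    (hab : a ≤ b) (hb : b ≤ 1) :
    ∫ x in a..b, (w' x * f x + w x * f' x) = w b * f b - w a * f a := by
  have hsub : Icc a b ⊆ Icc (-1 : ℝ) 1 := Icc_subset_Icc ha hb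
  have hac : AbsolutelyContinuousOnInterval (fun x => ∫ t in (-1 : ℝ)..x, f' t) a b :=
    hf.absolutelyContinuous_primitive.mono (by
      rw [uIcc_of_le hab, uIcc_of_le (by norm_num)]; exact hsub)
  have hdw : deriv w = w' := funext fun x => (hw x).deriv
  have hwac : AbsolutelyContinuousOnInterval w a b := by
    refine ContDiffOn.absolutelyContinuousOnInterval (ContDiff.contDiffOn ?_)
    rw [contDiff_one_iff_deriv, hdw]
    exact ⟨fun x => (hw x).differentiableAt, hw'⟩
  have h := hwac.integral_deriv_mul_eq_sub hac
  rw [hf.eq_integral (hsub (right_mem_Icc.2 hab)), hf.eq_integral (hsub (left_mem_Icc.2 hab)), ← h]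
  refine intervalIntegral.integral_congr_ae ?_
  filter_upwards [hf.ae_deriv_primitive] with x hx hx'
  rw [uIoc_of_le hab] at hx'
  have hx1 := hsub (Ioc_subset_Icc_self hx')
  rw [hx hx1, hdw, hf.eq_integral hx1]

theorem integral_deriv (hf : IsH10 f f') {a b : ℝ} (ha : -1 ≤ a) (hab : a ≤ b) (hb : b ≤ 1) :
    ∫ x in a..b, f' x = f b - f a := by
  simpa using hf.integral_deriv_mul_add (w := fun _ => 1) (w' := fun _ => 0)
    (fun x => hasDerivAt_const x 1) continuous_const ha hab hb

theorem integrableOn_deriv_sq (hf : IsH10 f f') :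
    IntegrableOn (fun x => f' x ^ 2) (Ioo (-1) 1) := hf.memLp_deriv.integrable_sq

/-- The sharp trace inequality `2 ψ(0)² ≤ ∫ |ψ'|²` on `H¹₀((-1,1))`. -/
theorem two_mul_sq_le (hf : IsH10 f f') : 2 * f 0 ^ 2 ≤ ∫ x in Ioo (-1 : ℝ) 1, f' x ^ 2 := by
  have hsq : IntervalIntegrable (fun x => f' x ^ 2) volume (-1) 1 := by
    rw [intervalIntegrable_iff_integrableOn_Ioo_of_le (by norm_num)]
    exact hf.integrableOn_deriv_sq
  have key : ∀ a b c : ℝ, -1 ≤ a → a ≤ b → b ≤ 1 →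
      0 ≤ (∫ x in a..b, f' x ^ 2) - 2 * c * (f b - f a) + c ^ 2 * (b - a) := by
    intro a b c ha hab hb
    have h1 := hf.intervalIntegrable_deriv_of_le ha hab hb
    have h2 : IntervalIntegrable (fun x => f' x ^ 2) volume a b := hsq.mono_set (by
      rw [uIcc_of_le hab, uIcc_of_le (by norm_num)]; exact Icc_subset_Icc ha hb)
    have h3 : ∫ x in a..b, (f' x - c) ^ 2
        = (∫ x in a..b, f' x ^ 2) - 2 * c * (f b - f a) + c ^ 2 * (b - a) := by
      have : ∀ x, (f' x - c) ^ 2 = f' x ^ 2 - 2 * c * f' x + c ^ 2 := fun x => by ring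
      simp only [this]
      rw [intervalIntegral.integral_add (h2.sub (h1.const_mul _)) (by simp),
        intervalIntegral.integral_sub h2 (h1.const_mul _), intervalIntegral.integral_const_mul,
        hf.integral_deriv ha hab hb]
      simp; ring
    rw [← h3]
    exact intervalIntegral.integral_nonneg hab fun x _ => sq_nonneg _
  -- The constants `± f 0` are the slopes of the tent of height `f 0`, the minimizer; each half
  -- contributes `f 0 ^ 2`.
  have k1 := key (-1) 0 (f 0) le_rfl (by norm_num) (by norm_num)
  have k2 := key 0 1 (-f 0) (by norm_num) (by norm_num) le_rfl
  rw [hf.left_eq_zero] at k1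
  rw [hf.right_eq_zero] at k2
  have hsplit := intervalIntegral.integral_add_adjacent_intervals
    (hsq.mono_set (c := -1) (d := 0) (by
      rw [uIcc_of_le (by norm_num), uIcc_of_le (by norm_num)]
      exact Icc_subset_Icc le_rfl (by norm_num)))
    (hsq.mono_set (c := 0) (d := 1) (by
      rw [uIcc_of_le (by norm_num), uIcc_of_le (by norm_num)]
      exact Icc_subset_Icc (by norm_num) le_rfl))
  rw [← integral_Ioc_eq_integral_Ioo, ← intervalIntegral.integral_of_le (by norm_num), ← hsplit]
  nlinarith

/-- If the weak derivative of an `H¹₀` function has zero `L²` norm, the function vanishes. -/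
theorem eq_zero_of_integral_sq_nonpos (hf : IsH10 f f')
    (h : ∫ x in Ioo (-1 : ℝ) 1, f' x ^ 2 ≤ 0) {x : ℝ} (hx : x ∈ Icc (-1 : ℝ) 1) : f x = 0 := by
  have h0 : ∫ x in Ioo (-1 : ℝ) 1, f' x ^ 2 = 0 :=
    le_antisymm h (integral_nonneg fun x => sq_nonneg _)
  rw [integral_eq_zero_iff_of_nonneg (fun x => sq_nonneg _) hf.integrableOn_deriv_sq,
    EventuallyEq, restrict_Ioo_eq_restrict_Ioc, ae_restrict_iff' measurableSet_Ioc] at h0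
  rw [hf.eq_integral hx]
  refine intervalIntegral.integral_zero_ae ?_
  filter_upwards [h0] with t ht ht'
  rw [uIoc_of_le hx.1] at ht'
  simpa using ht ⟨ht'.1, ht'.2.trans hx.2⟩

/-- A continuous, piecewise `C¹` function vanishing at the end points is in `H¹₀`. -/
theorem of_hasDerivAt_off_zero (hc : ContinuousOn f (Icc (-1) 1))
    (hd : ∀ x ∈ Ioo (-1 : ℝ) 1 \ {0}, HasDerivAt f (f' x) x)
    (hm : MemLp f' 2 (volume.restrict (Ioo (-1) 1))) (hl : f (-1) = 0) (hr : f 1 = 0) :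
    IsH10 f f' where
  continuousOn := hc
  memLp_deriv := hm
  left_eq_zero := hl
  right_eq_zero := hr
  weak_deriv := by
    intro φ hφ hφc hφt
    have hdc : Continuous (deriv φ) := hφ.continuous_deriv (by simp)
    have huIcc : uIcc (-1 : ℝ) 1 = Icc (-1) 1 := uIcc_of_le (by norm_num)
    have hi' : IntervalIntegrable f' volume (-1) 1 := by
      rw [intervalIntegrable_iff_integrableOn_Ioo_of_le (by norm_num)]
      exact hm.integrable (by norm_num)
    have i1 : IntervalIntegrable (fun x => f' x * φ x) volume (-1) 1 :=
      hi'.mul_continuousOn hφ.continuous.continuousOn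
    have i2 : IntervalIntegrable (fun x => f x * deriv φ x) volume (-1) 1 :=
      ContinuousOn.intervalIntegrable (by rw [huIcc]; exact hc.mul hdc.continuousOn)
    have h := MeasureTheory.integral_eq_of_hasDerivAt_off_countable_of_le (fun x => f x * φ x)
      (fun x => f' x * φ x + f x * deriv φ x) (show (-1 : ℝ) ≤ 1 by norm_num)
      (countable_singleton 0) (hc.mul hφ.continuous.continuousOn)
      (fun x hx => (hd x hx).mul ((hφ.differentiable (by simp)) x).hasDerivAt) (i1.add i2)
    rw [intervalIntegral.integral_add i1 i2, hl, hr] at h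
    rw [← integral_Ioc_eq_integral_Ioo, ← integral_Ioc_eq_integral_Ioo,
      ← intervalIntegral.integral_of_le (by norm_num),
      ← intervalIntegral.integral_of_le (by norm_num)]
    linarith

end IsH10

/-! ### The constant-coefficient equation as a first-order system -/

/-- The companion operator of the scalar equation `u'''' = c₀ u + c₂ u''`. -/
noncomputable def companion (c₀ c₂ : ℝ) : (Fin 4 → ℝ) →L[ℝ] (Fin 4 → ℝ) :=
  LinearMap.toContinuousLinearMap
    (Matrix.toLin' !![0, 1, 0, 0; 0, 0, 1, 0; 0, 0, 0, 1; c₀, 0, c₂, 0])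

theorem companion_apply (c₀ c₂ : ℝ) (y : Fin 4 → ℝ) :
    companion c₀ c₂ y = ![y 1, y 2, y 3, c₀ * y 0 + c₂ * y 2] := by
  ext i
  fin_cases i <;> simp [companion, Matrix.toLin'_apply, Matrix.mulVec, dotProduct,
    Fin.sum_univ_four]

/-- The flow of `u'''' = c₀ u + c₂ u''` acting on the states `(u, u', u'', u''')`. -/
noncomputable def stateFlow (c₀ c₂ x : ℝ) : (Fin 4 → ℝ) →L[ℝ] (Fin 4 → ℝ) :=
  NormedSpace.exp (x • companion c₀ c₂)

theorem stateFlow_zero (c₀ c₂ : ℝ) : stateFlow c₀ c₂ 0 = 1 := by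
  simp [stateFlow]

theorem stateFlow_mul_neg (c₀ c₂ x : ℝ) : stateFlow c₀ c₂ x * stateFlow c₀ c₂ (-x) = 1 := by
  let _ : NormedAlgebra ℚ ((Fin 4 → ℝ) →L[ℝ] (Fin 4 → ℝ)) := NormedAlgebra.restrictScalars ℚ ℝ _
  rw [stateFlow, stateFlow, ← NormedSpace.exp_add_of_commute]
  · rw [← add_smul, add_neg_cancel, zero_smul, NormedSpace.exp_zero]
  · exact ((Commute.refl (companion c₀ c₂)).smul_left x).smul_right (-x)

theorem hasDerivAt_stateFlow (c₀ c₂ x : ℝ) :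
    HasDerivAt (stateFlow c₀ c₂) (companion c₀ c₂ * stateFlow c₀ c₂ x) x :=
  hasDerivAt_exp_smul_const' (companion c₀ c₂) x

theorem hasDerivAt_stateFlow' (c₀ c₂ x : ℝ) :
    HasDerivAt (stateFlow c₀ c₂) (stateFlow c₀ c₂ x * companion c₀ c₂) x :=
  hasDerivAt_exp_smul_const (companion c₀ c₂) x

/-- `u` is the state `(u, u', u'', u''')` of a solution of `u'''' = c₀ u + c₂ u''` on `s`. -/
structure IsStateOn (c₀ c₂ : ℝ) (s : Set ℝ) (u : ℝ → Fin 4 → ℝ) : Prop where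
  hasDerivAt_zero : ∀ x ∈ s, HasDerivAt (fun t => u t 0) (u x 1) x
  hasDerivAt_one : ∀ x ∈ s, HasDerivAt (fun t => u t 1) (u x 2) x
  hasDerivAt_two : ∀ x ∈ s, HasDerivAt (fun t => u t 2) (u x 3) x
  hasDerivAt_three : ∀ x ∈ s, HasDerivAt (fun t => u t 3) (c₀ * u x 0 + c₂ * u x 2) x

theorem IsStateOn.hasDerivAt {c₀ c₂ : ℝ} {s : Set ℝ} {u : ℝ → Fin 4 → ℝ}
    (hu : IsStateOn c₀ c₂ s u) {x : ℝ} (hx : x ∈ s) :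
    HasDerivAt u (companion c₀ c₂ (u x)) x := by
  rw [hasDerivAt_pi, companion_apply]
  intro i
  fin_cases i
  · exact hu.hasDerivAt_zero x hx
  · exact hu.hasDerivAt_one x hx
  · exact hu.hasDerivAt_two x hx
  · exact hu.hasDerivAt_three x hx

theorem isStateOn_stateFlow (c₀ c₂ : ℝ) (c : Fin 4 → ℝ) :
    IsStateOn c₀ c₂ univ (fun x => stateFlow c₀ c₂ x c) := by
  have h : ∀ x i, HasDerivAt (fun t => stateFlow c₀ c₂ t c i)
      (companion c₀ c₂ (stateFlow c₀ c₂ x c) i) x := by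
    intro x
    have := (hasDerivAt_stateFlow c₀ c₂ x).clm_apply (hasDerivAt_const x c)
    rw [hasDerivAt_pi] at this
    simpa using this
  simp only [companion_apply] at h
  exact ⟨fun x _ => h x 0, fun x _ => h x 1, fun x _ => h x 2, fun x _ => h x 3⟩

/-- Transporting the state back to `0` by the inverse flow gives a function with zero derivative.
The constant is thus the state at `0`, even if `0` is not in the interval, and the solution extends
smoothly to the whole line, so that one-sided limits become values. -/
theorem IsStateOn.exists_eq_stateFlow {c₀ c₂ a b : ℝ} {u : ℝ → Fin 4 → ℝ} (hab : a < b)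
    (hu : IsStateOn c₀ c₂ (Ioo a b) u) :
    ∃ c : Fin 4 → ℝ, ∀ x ∈ Ioo a b, u x = stateFlow c₀ c₂ x c := by
  have hd : ∀ x ∈ Ioo a b, HasDerivAt (fun t => stateFlow c₀ c₂ (-t) (u t)) 0 x := by
    intro x hx
    have h1 : HasDerivAt (fun t => stateFlow c₀ c₂ (-t))
        (-(stateFlow c₀ c₂ (-x) * companion c₀ c₂)) x := by
      simpa [Function.comp_def] using (hasDerivAt_stateFlow' c₀ c₂ (-x)).scomp x (hasDerivAt_neg x)
    simpa using h1.clm_apply (hu.hasDerivAt hx)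
  obtain ⟨x₀, hx₀⟩ : (Ioo a b).Nonempty := nonempty_Ioo.2 hab
  refine ⟨stateFlow c₀ c₂ (-x₀) (u x₀), fun x hx => ?_⟩
  have hconst := isOpen_Ioo.is_const_of_deriv_eq_zero isPreconnected_Ioo
    (fun x hx => (hd x hx).differentiableAt.differentiableWithinAt)
    (fun x hx => (hd x hx).deriv) hx hx₀
  rw [← hconst, ← mul_apply_eq_comp, stateFlow_mul_neg]
  simp

namespace IsStateOn

variable {c₀ c₂ : ℝ} {u : ℝ → Fin 4 → ℝ}

/-- Bootstrapping: the derivative of the state is a linear image of the state, so each order of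
smoothness gives the next. -/
theorem contDiff (hu : IsStateOn c₀ c₂ univ u) (i : Fin 4) :
    ContDiff ℝ ∞ (fun x => u x i) := by
  have hd : Differentiable ℝ u := fun x => (hu.hasDerivAt (mem_univ x)).differentiableAt
  have key : ∀ n : ℕ, ContDiff ℝ n u := by
    intro n
    induction n with
    | zero => exact contDiff_zero.2 hd.continuous
    | succ n ih =>
      rw [Nat.cast_succ, contDiff_succ_iff_deriv]
      refine ⟨hd, by simp, ?_⟩
      have : deriv u = fun x => companion c₀ c₂ (u x) :=
        funext fun x => (hu.hasDerivAt (mem_univ x)).deriv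
      rw [this]
      exact (companion c₀ c₂).contDiff.comp ih
  exact contDiff_pi.1 (contDiff_infty.2 key) i

theorem continuous (hu : IsStateOn c₀ c₂ univ u) (i : Fin 4) : Continuous fun x => u x i :=
  (hu.contDiff i).continuous

theorem deriv_eq (hu : IsStateOn c₀ c₂ univ u) : deriv (fun x => u x 0) = fun x => u x 1 :=
  funext fun x => (hu.hasDerivAt_zero x (mem_univ x)).deriv

theorem iteratedDeriv_two (hu : IsStateOn c₀ c₂ univ u) :
    iteratedDeriv 2 (fun x => u x 0) = fun x => u x 2 := by
  rw [iteratedDeriv_succ, iteratedDeriv_one, hu.deriv_eq]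
  exact funext fun x => (hu.hasDerivAt_one x (mem_univ x)).deriv

theorem iteratedDeriv_three (hu : IsStateOn c₀ c₂ univ u) :
    iteratedDeriv 3 (fun x => u x 0) = fun x => u x 3 := by
  rw [iteratedDeriv_succ, hu.iteratedDeriv_two]
  exact funext fun x => (hu.hasDerivAt_two x (mem_univ x)).deriv

theorem iteratedDeriv_four (hu : IsStateOn c₀ c₂ univ u) :
    iteratedDeriv 4 (fun x => u x 0) = fun x => c₀ * u x 0 + c₂ * u x 2 := by
  rw [iteratedDeriv_succ, hu.iteratedDeriv_three]
  exact funext fun x => (hu.hasDerivAt_three x (mem_univ x)).deriv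

/-- If the first component of a state vanishes on an open interval, so does the state on its
closure. -/
theorem eq_zero_of_eqOn (hu : IsStateOn c₀ c₂ univ u) {a b : ℝ} (hab : a < b)
    (h : ∀ x ∈ Ioo a b, u x 0 = 0) {x : ℝ} (hx : x ∈ Icc a b) : u x = 0 := by
  have step : ∀ i j : Fin 4, (∀ x, HasDerivAt (fun t => u t i) (u x j) x) →
      (∀ x ∈ Ioo a b, u x i = 0) → ∀ x ∈ Ioo a b, u x j = 0 := by
    intro i j hd hi x hx
    have h0 : HasDerivAt (fun t => u t i) 0 x := by
      refine (hasDerivAt_const x (0 : ℝ)).congr_of_eventuallyEq ?_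
      filter_upwards [isOpen_Ioo.mem_nhds hx] with t ht using hi t ht
    exact (hd x).unique h0
  have h1 := step 0 1 (fun x => hu.hasDerivAt_zero x (mem_univ x)) h
  have h2 := step 1 2 (fun x => hu.hasDerivAt_one x (mem_univ x)) h1
  have h3 := step 2 3 (fun x => hu.hasDerivAt_two x (mem_univ x)) h2
  have hcl : ∀ i : Fin 4, (∀ x ∈ Ioo a b, u x i = 0) → u x i = 0 := by
    intro i hi
    have : Icc a b ⊆ {x | u x i = 0} := by
      rw [← closure_Ioo hab.ne]
      exact closure_minimal hi (isClosed_eq (hu.continuous i) continuous_const)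
    exact this hx
  ext i
  fin_cases i
  exacts [hcl 0 h, hcl 1 h1, hcl 2 h2, hcl 3 h3]

end IsStateOn

/-! ### The energy form and its dependence on the growth rate -/

/-- The bilinear density of the energy form in a fluid of density `ρ` and viscosity `μ`. -/
def formDensity (ρ μ B ξ lam a₀ a₁ a₂ b₀ b₁ b₂ : ℝ) : ℝ :=
  lam ^ 2 * ρ * (ξ ^ 2 * (a₀ * b₀) + a₁ * b₁) +
    lam * μ * ((ξ ^ 2 * a₀ + a₂) * (ξ ^ 2 * b₀ + b₂) + 4 * ξ ^ 2 * (a₁ * b₁)) +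
    B ^ 2 * (ξ ^ 2 * (a₁ * b₁) + a₂ * b₂)

/-- The energy form on triples `(a, a', a'')`. -/
noncomputable def energyForm (ρp ρm μp μm B ξ lam : ℝ) (a a' a'' b b' b'' : ℝ → ℝ) : ℝ :=
  ∫ x in Ioo (-1 : ℝ) 1, formDensity (twoPhase ρp ρm x) (twoPhase μp μm x) B ξ lam
    (a x) (a' x) (a'' x) (b x) (b' x) (b'' x)

/-- The coefficient of `u` when the normal-mode equation is solved for `u''''`. -/
noncomputable def coeffZero (ρ μ B ξ lam : ℝ) : ℝ :=
  -(lam * μ * ξ ^ 4 + lam ^ 2 * ρ * ξ ^ 2) / (lam * μ + B ^ 2)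

/-- The coefficient of `u''` when the normal-mode equation is solved for `u''''`. -/
noncomputable def coeffTwo (ρ μ B ξ lam : ℝ) : ℝ :=
  (lam ^ 2 * ρ + 2 * lam * μ * ξ ^ 2 + B ^ 2 * ξ ^ 2) / (lam * μ + B ^ 2)

/-- The natural boundary term paired with the derivative of a test function. -/
def moment (μ B ξ lam : ℝ) (y : Fin 4 → ℝ) : ℝ :=
  lam * μ * (ξ ^ 2 * y 0 + y 2) + B ^ 2 * y 2

/-- The natural boundary term paired with the value of a test function. -/
def shear (ρ μ B ξ lam : ℝ) (y : Fin 4 → ℝ) : ℝ :=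
  (lam ^ 2 * ρ + 3 * lam * μ * ξ ^ 2 + B ^ 2 * ξ ^ 2) * y 1 - (lam * μ + B ^ 2) * y 3

section density

variable {ρ μ B ξ lam : ℝ}

theorem mul_le_formDensity (hμ : 0 ≤ μ) (hl : 0 ≤ lam) (hρ : 0 ≤ ρ) (a₀ a₁ a₂ : ℝ) :
    lam ^ 2 * ρ * a₁ ^ 2 + B ^ 2 * (ξ ^ 2 * a₁ ^ 2 + a₂ ^ 2)
      ≤ formDensity ρ μ B ξ lam a₀ a₁ a₂ a₀ a₁ a₂ := by
  have h1 : 0 ≤ lam ^ 2 * ρ * (ξ ^ 2 * a₀ ^ 2) := by positivity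
  have h2 : 0 ≤ lam * μ * ((ξ ^ 2 * a₀ + a₂) ^ 2 + 4 * ξ ^ 2 * a₁ ^ 2) := by positivity
  unfold formDensity
  nlinarith

theorem formDensity_nonneg (hμ : 0 ≤ μ) (hl : 0 ≤ lam) (hρ : 0 ≤ ρ) (a₀ a₁ a₂ : ℝ) :
    0 ≤ formDensity ρ μ B ξ lam a₀ a₁ a₂ a₀ a₁ a₂ :=
  le_trans (by positivity) (mul_le_formDensity hμ hl hρ a₀ a₁ a₂)

theorem formDensity_mono {lam' : ℝ} (hμ : 0 ≤ μ) (hl : 0 ≤ lam) (hll : lam ≤ lam') (hρ : 0 ≤ ρ)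
    (a₀ a₁ a₂ : ℝ) :
    formDensity ρ μ B ξ lam a₀ a₁ a₂ a₀ a₁ a₂ ≤ formDensity ρ μ B ξ lam' a₀ a₁ a₂ a₀ a₁ a₂ := by
  have h0 : lam ^ 2 ≤ lam' ^ 2 := by gcongr
  have h1 : 0 ≤ ρ * (ξ ^ 2 * (a₀ * a₀) + a₁ * a₁) := by
    have := mul_self_nonneg a₀; have := mul_self_nonneg a₁; positivity
  have h2 : 0 ≤ μ * ((ξ ^ 2 * a₀ + a₂) * (ξ ^ 2 * a₀ + a₂) + 4 * ξ ^ 2 * (a₁ * a₁)) := by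
    have := mul_self_nonneg (ξ ^ 2 * a₀ + a₂); have := mul_self_nonneg a₁; positivity
  unfold formDensity
  nlinarith [mul_le_mul_of_nonneg_right h0 h1, mul_le_mul_of_nonneg_right hll h2]

/-- The diagonal density is a polynomial `λ²P + λQ + R`; after division by `λ²` the remaining `Q/λ +
R/λ²` decreases since `Q, R ≥ 0`. The bound is stated without the division. -/
theorem sq_mul_formDensity_le {lam' : ℝ} (hμ : 0 ≤ μ) (hl : 0 ≤ lam) (hll : lam ≤ lam')
    (a₀ a₁ a₂ : ℝ) :
    lam ^ 2 * formDensity ρ μ B ξ lam' a₀ a₁ a₂ a₀ a₁ a₂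
      ≤ lam' ^ 2 * formDensity ρ μ B ξ lam a₀ a₁ a₂ a₀ a₁ a₂ := by
  have h0 : lam ^ 2 ≤ lam' ^ 2 := by gcongr
  have h1 : 0 ≤ B ^ 2 * (ξ ^ 2 * (a₁ * a₁) + a₂ * a₂) := by
    have := mul_self_nonneg a₁; have := mul_self_nonneg a₂; positivity
  have h2 : 0 ≤ μ * ((ξ ^ 2 * a₀ + a₂) * (ξ ^ 2 * a₀ + a₂) + 4 * ξ ^ 2 * (a₁ * a₁)) := by
    have := mul_self_nonneg (ξ ^ 2 * a₀ + a₂); have := mul_self_nonneg a₁; positivity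
  have h3 : lam ^ 2 * lam' ≤ lam' ^ 2 * lam := by nlinarith [mul_nonneg hl (hl.trans hll)]
  unfold formDensity
  nlinarith [mul_le_mul_of_nonneg_right h0 h1, mul_le_mul_of_nonneg_right h3 h2]

end density

theorem twoPhase_nonneg {ap am : ℝ} (hp : 0 ≤ ap) (hm : 0 ≤ am) (x : ℝ) :
    0 ≤ twoPhase ap am x := by
  unfold twoPhase; split_ifs <;> assumption

theorem le_twoPhase {ap am c : ℝ} (hp : c ≤ ap) (hm : c ≤ am) (x : ℝ) :
    c ≤ twoPhase ap am x := by
  unfold twoPhase; split_ifs <;> assumption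

theorem integrable_formDensity_const {ν : Measure ℝ} (ρ μ B ξ lam : ℝ)
    {a₀ a₁ a₂ b₀ b₁ b₂ : ℝ → ℝ} (h₀ : MemLp a₀ 2 ν) (h₁ : MemLp a₁ 2 ν) (h₂ : MemLp a₂ 2 ν)
    (k₀ : MemLp b₀ 2 ν) (k₁ : MemLp b₁ 2 ν) (k₂ : MemLp b₂ 2 ν) :
    Integrable (fun x => formDensity ρ μ B ξ lam (a₀ x) (a₁ x) (a₂ x) (b₀ x) (b₁ x) (b₂ x)) ν := by
  have i00 : Integrable (fun x => a₀ x * b₀ x) ν := h₀.integrable_mul k₀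
  have i11 : Integrable (fun x => a₁ x * b₁ x) ν := h₁.integrable_mul k₁
  have i22 : Integrable (fun x => a₂ x * b₂ x) ν := h₂.integrable_mul k₂
  have ix : Integrable (fun x => (ξ ^ 2 * a₀ x + a₂ x) * (ξ ^ 2 * b₀ x + b₂ x)) ν :=
    ((h₀.const_mul (ξ ^ 2)).add h₂).integrable_mul ((k₀.const_mul (ξ ^ 2)).add k₂)
  exact ((((i00.const_mul _).add i11).const_mul _).add
    ((ix.add (i11.const_mul _)).const_mul _)).add (((i11.const_mul _).add i22).const_mul _)

theorem integrable_formDensity {ν : Measure ℝ} (ρp ρm μp μm B ξ lam : ℝ)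
    {a₀ a₁ a₂ b₀ b₁ b₂ : ℝ → ℝ} (h₀ : MemLp a₀ 2 ν) (h₁ : MemLp a₁ 2 ν) (h₂ : MemLp a₂ 2 ν)
    (k₀ : MemLp b₀ 2 ν) (k₁ : MemLp b₁ 2 ν) (k₂ : MemLp b₂ 2 ν) :
    Integrable (fun x => formDensity (twoPhase ρp ρm x) (twoPhase μp μm x) B ξ lam
      (a₀ x) (a₁ x) (a₂ x) (b₀ x) (b₁ x) (b₂ x)) ν := by
  have hp := integrable_formDensity_const ρp μp B ξ lam h₀ h₁ h₂ k₀ k₁ k₂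
  have hm := integrable_formDensity_const ρm μm B ξ lam h₀ h₁ h₂ k₀ k₁ k₂
  refine (Integrable.piecewise (s := Ioi 0) measurableSet_Ioi hp.integrableOn
    hm.integrableOn).congr (Eventually.of_forall fun x => ?_)
  by_cases hx : 0 < x
  · simp [hx, twoPhase]
  · simp [hx, twoPhase]

section form

variable {ρp ρm μp μm B ξ lam : ℝ} {a a' a'' b b' b'' : ℝ → ℝ}

theorem IsH20.integrable_formDensity (ha : IsH20 a a' a'') (hb : IsH20 b b' b'') :
    Integrable (fun x => formDensity (twoPhase ρp ρm x) (twoPhase μp μm x) B ξ lam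
      (a x) (a' x) (a'' x) (b x) (b' x) (b'' x)) (volume.restrict (Ioo (-1) 1)) :=
  _root_.integrable_formDensity ρp ρm μp μm B ξ lam ha.fst.memLp ha.snd.memLp
    ha.snd.memLp_deriv hb.fst.memLp hb.snd.memLp hb.snd.memLp_deriv

/-- The energy form controls the `ρ`-weighted kinetic part and the magnetic part. -/
theorem IsH20.le_energyForm (ha : IsH20 a a' a'') (hμp : 0 ≤ μp) (hμm : 0 ≤ μm)
    (hρm : 0 ≤ ρm) (hρ : ρm ≤ ρp) (hl : 0 ≤ lam) :
    lam ^ 2 * ρm * (∫ x in Ioo (-1 : ℝ) 1, a' x ^ 2) +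
      B ^ 2 * (ξ ^ 2 * (∫ x in Ioo (-1 : ℝ) 1, a' x ^ 2) + ∫ x in Ioo (-1 : ℝ) 1, a'' x ^ 2)
      ≤ energyForm ρp ρm μp μm B ξ lam a a' a'' a a' a'' := by
  have i1 : Integrable (fun x => a' x ^ 2) (volume.restrict (Ioo (-1) 1)) :=
    ha.fst.integrableOn_deriv_sq
  have i2 : Integrable (fun x => a'' x ^ 2) (volume.restrict (Ioo (-1) 1)) :=
    ha.snd.integrableOn_deriv_sq
  have i3 := (i1.const_mul (ξ ^ 2)).fun_add i2
  rw [← integral_const_mul, ← integral_const_mul (ξ ^ 2), ← integral_add (i1.const_mul _) i2,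
    ← integral_const_mul, ← integral_add (i1.const_mul _) (i3.const_mul _)]
  refine integral_mono ((i1.const_mul _).fun_add (i3.const_mul _))
    (ha.integrable_formDensity ha) fun x => ?_
  refine le_trans ?_ (mul_le_formDensity (twoPhase_nonneg hμp hμm x) hl
    (twoPhase_nonneg (hρm.trans hρ) hρm x) (a x) (a' x) (a'' x))
  have := mul_le_mul_of_nonneg_right (mul_le_mul_of_nonneg_left
    (le_twoPhase hρ le_rfl x) (sq_nonneg lam)) (sq_nonneg (a' x))
  simpa using this

theorem IsH20.energyForm_mono (ha : IsH20 a a' a'') {lam' : ℝ} (hμp : 0 ≤ μp) (hμm : 0 ≤ μm)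
    (hρp : 0 ≤ ρp) (hρm : 0 ≤ ρm) (hl : 0 ≤ lam) (hll : lam ≤ lam') :
    energyForm ρp ρm μp μm B ξ lam a a' a'' a a' a''
      ≤ energyForm ρp ρm μp μm B ξ lam' a a' a'' a a' a'' :=
  integral_mono (ha.integrable_formDensity ha) (ha.integrable_formDensity ha) fun x =>
    formDensity_mono (twoPhase_nonneg hμp hμm x) hl hll (twoPhase_nonneg hρp hρm x) _ _ _

theorem IsH20.sq_mul_energyForm_le (ha : IsH20 a a' a'') {lam' : ℝ} (hμp : 0 ≤ μp)
    (hμm : 0 ≤ μm) (hl : 0 ≤ lam) (hll : lam ≤ lam') :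
    lam ^ 2 * energyForm ρp ρm μp μm B ξ lam' a a' a'' a a' a''
      ≤ lam' ^ 2 * energyForm ρp ρm μp μm B ξ lam a a' a'' a a' a'' := by
  unfold energyForm
  rw [← integral_const_mul, ← integral_const_mul]
  exact integral_mono ((ha.integrable_formDensity ha).const_mul _)
    ((ha.integrable_formDensity ha).const_mul _) fun x =>
      sq_mul_formDensity_le (twoPhase_nonneg hμp hμm x) hl hll _ _ _

/-- Nonnegativity of the energy form at `b - s a`. -/
theorem IsH20.energyForm_sub_nonneg (ha : IsH20 a a' a'') (hb : IsH20 b b' b'')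
    (hμp : 0 ≤ μp) (hμm : 0 ≤ μm) (hρp : 0 ≤ ρp) (hρm : 0 ≤ ρm) (hl : 0 ≤ lam) (s : ℝ) :
    0 ≤ energyForm ρp ρm μp μm B ξ lam b b' b'' b b' b'' -
      2 * s * energyForm ρp ρm μp μm B ξ lam a a' a'' b b' b'' +
      s ^ 2 * energyForm ρp ρm μp μm B ξ lam a a' a'' a a' a'' := by
  unfold energyForm
  rw [sub_eq_add_neg, ← neg_mul, ← integral_const_mul, ← integral_const_mul,
    ← integral_add (hb.integrable_formDensity hb)
    ((ha.integrable_formDensity hb).const_mul _), ← integral_add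
    ((hb.integrable_formDensity hb).fun_add ((ha.integrable_formDensity hb).const_mul _))
    ((ha.integrable_formDensity ha).const_mul _)]
  refine integral_nonneg fun x => ?_
  refine (formDensity_nonneg (B := B) (ξ := ξ) (twoPhase_nonneg hμp hμm x) hl
    (twoPhase_nonneg hρp hρm x) (b x - s * a x) (b' x - s * a' x) (b'' x - s * a'' x)).trans_eq ?_
  simp only [formDensity]
  ring

/-- As `lam → 0` the energy form tends to its magnetic part. -/
theorem IsH20.tendsto_energyForm_zero (ha : IsH20 a a' a'') :
    Tendsto (fun lam => energyForm ρp ρm μp μm B ξ lam a a' a'' a a' a'') (𝓝 0)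
      (𝓝 (B ^ 2 * (ξ ^ 2 * (∫ x in Ioo (-1 : ℝ) 1, a' x ^ 2) +
        ∫ x in Ioo (-1 : ℝ) 1, a'' x ^ 2))) := by
  have i1 : Integrable (fun x => a' x ^ 2) (volume.restrict (Ioo (-1) 1)) :=
    ha.fst.integrableOn_deriv_sq
  have i2 : Integrable (fun x => a'' x ^ 2) (volume.restrict (Ioo (-1) 1)) :=
    ha.snd.integrableOn_deriv_sq
  have i3 := ((i1.const_mul (ξ ^ 2)).fun_add i2).const_mul (B ^ 2)
  have j1 := ha.integrable_formDensity (ρp := ρp) (ρm := ρm) (μp := 0) (μm := 0) (B := 0) (ξ := ξ)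
    (lam := 1) ha
  have j2 := ha.integrable_formDensity (ρp := 0) (ρm := 0) (μp := μp) (μm := μm) (B := 0) (ξ := ξ)
    (lam := 1) ha
  -- The form is a quadratic polynomial in `lam`; its coefficients are isolated by switching off the
  -- other two effects and setting `lam = 1`.
  have key : ∀ lam, energyForm ρp ρm μp μm B ξ lam a a' a'' a a' a'' =
      lam ^ 2 * energyForm ρp ρm 0 0 0 ξ 1 a a' a'' a a' a'' +
      lam * energyForm 0 0 μp μm 0 ξ 1 a a' a'' a a' a'' +
      B ^ 2 * (ξ ^ 2 * (∫ x in Ioo (-1 : ℝ) 1, a' x ^ 2) +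
        ∫ x in Ioo (-1 : ℝ) 1, a'' x ^ 2) := by
    intro lam
    unfold energyForm
    rw [← integral_const_mul, ← integral_const_mul, ← integral_const_mul (ξ ^ 2),
      ← integral_add (i1.const_mul _) i2, ← integral_const_mul,
      ← integral_add (j1.const_mul _) (j2.const_mul _),
      ← integral_add ((j1.const_mul _).fun_add (j2.const_mul _)) i3]
    refine integral_congr_ae (Eventually.of_forall fun x => ?_)
    have h0 : twoPhase 0 0 x = 0 := by simp [twoPhase]
    simp only [formDensity, h0]
    ring
  simp only [key]
  refine Tendsto.congr' (Eventually.of_forall fun _ => rfl) (Continuous.tendsto' ?_ _ _ ?_)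
  · fun_prop
  · simp

end form

/-! ### The weak formulation in a single fluid -/

theorem IsH10.intervalIntegrable_deriv_mul_add {f f' : ℝ → ℝ} (hf : IsH10 f f') {w w' : ℝ → ℝ}
    (hw : Continuous w) (hw' : Continuous w') {a b : ℝ} (ha : -1 ≤ a) (hab : a ≤ b)
    (hb : b ≤ 1) :
    IntervalIntegrable (fun x => w' x * f x + w x * f' x) volume a b := by
  refine IntervalIntegrable.add (ContinuousOn.intervalIntegrable ?_)
    ((hf.intervalIntegrable_deriv_of_le ha hab hb).continuousOn_mul hw.continuousOn)
  rw [uIcc_of_le hab]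
  exact hw'.continuousOn.mul (hf.continuousOn.mono (Icc_subset_Icc ha hb))

/-- Integration by parts of the energy density of a solution against a test function. -/
theorem IsStateOn.integral_formDensity {ρ μ B ξ lam : ℝ} {u : ℝ → Fin 4 → ℝ} {φ φ' φ'' : ℝ → ℝ}
    (hu : IsStateOn (coeffZero ρ μ B ξ lam) (coeffTwo ρ μ B ξ lam) univ u)
    (hpos : 0 < lam * μ + B ^ 2) (hφ : IsH20 φ φ' φ'') {a b : ℝ} (ha : -1 ≤ a) (hab : a ≤ b)
    (hb : b ≤ 1) :
    ∫ x in a..b, formDensity ρ μ B ξ lam (u x 0) (u x 1) (u x 2) (φ x) (φ' x) (φ'' x) =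
      (moment μ B ξ lam (u b) * φ' b + shear ρ μ B ξ lam (u b) * φ b) -
        (moment μ B ξ lam (u a) * φ' a + shear ρ μ B ξ lam (u a) * φ a) := by
  have d0 := fun x => hu.hasDerivAt_zero x (mem_univ x)
  have d1 := fun x => hu.hasDerivAt_one x (mem_univ x)
  have d2 := fun x => hu.hasDerivAt_two x (mem_univ x)
  have d3 := fun x => hu.hasDerivAt_three x (mem_univ x)
  have c0 := hu.continuous 0
  have c1 := hu.continuous 1
  have c2 := hu.continuous 2
  have c3 := hu.continuous 3
  set M' : ℝ → ℝ := fun x => lam * μ * (ξ ^ 2 * u x 1 + u x 3) + B ^ 2 * u x 3 with hM'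
  set S' : ℝ → ℝ := fun x => (lam ^ 2 * ρ + 3 * lam * μ * ξ ^ 2 + B ^ 2 * ξ ^ 2) * u x 2 -
    (lam * μ + B ^ 2) * (coeffZero ρ μ B ξ lam * u x 0 + coeffTwo ρ μ B ξ lam * u x 2) with hS'
  have hM : ∀ x, HasDerivAt (fun t => moment μ B ξ lam (u t)) (M' x) x := fun x =>
    ((((d0 x).const_mul (ξ ^ 2)).add (d2 x)).const_mul (lam * μ)).add ((d2 x).const_mul (B ^ 2))
  have hS : ∀ x, HasDerivAt (fun t => shear ρ μ B ξ lam (u t)) (S' x) x := fun x =>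
    ((d1 x).const_mul _).sub ((d3 x).const_mul _)
  have hM'c : Continuous M' := by fun_prop
  have hS'c : Continuous S' := by fun_prop
  have hMc : Continuous (fun t => moment μ B ξ lam (u t)) := by unfold moment; fun_prop
  have hSc : Continuous (fun t => shear ρ μ B ξ lam (u t)) := by unfold shear; fun_prop
  have e1 := hφ.snd.integral_deriv_mul_add hM hM'c ha hab hb
  have e2 := hφ.fst.integral_deriv_mul_add hS hS'c ha hab hb
  have e3 := intervalIntegral.integral_add
    (hφ.snd.intervalIntegrable_deriv_mul_add hMc hM'c ha hab hb)
    (hφ.fst.intervalIntegrable_deriv_mul_add hSc hS'c ha hab hb)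
  have hz : (lam * μ + B ^ 2) * coeffZero ρ μ B ξ lam
      = -(lam * μ * ξ ^ 4 + lam ^ 2 * ρ * ξ ^ 2) := by
    unfold coeffZero; field_simp
  have ht : (lam * μ + B ^ 2) * coeffTwo ρ μ B ξ lam
      = lam ^ 2 * ρ + 2 * lam * μ * ξ ^ 2 + B ^ 2 * ξ ^ 2 := by
    unfold coeffTwo; field_simp
  -- The density is the derivative of `moment * φ' + shear * φ`: the coefficients of `φ''` and `φ'`
  -- match by the definitions of `moment` and `shear`, and that of `φ` matches by the differential
  -- equation.
  have e4 : ∫ x in a..b, formDensity ρ μ B ξ lam (u x 0) (u x 1) (u x 2) (φ x) (φ' x) (φ'' x) =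
      ∫ x in a..b, ((M' x * φ' x + moment μ B ξ lam (u x) * φ'' x) +
        (S' x * φ x + shear ρ μ B ξ lam (u x) * φ' x)) := by
    refine intervalIntegral.integral_congr fun x _ => ?_
    simp only [hM', hS', formDensity, moment, shear]
    linear_combination (φ x * u x 0) * hz + (φ x * u x 2) * ht
  rw [e4, e3, e1, e2]
  ring

/-! ### Gluing the two fluids: the transmission problem -/

/-- The function equal to `v` on `(-∞,0]` and to `u` on `(0,∞)`. -/
noncomputable def glue (u v : ℝ → ℝ) (x : ℝ) : ℝ := if x ≤ 0 then v x else u x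

section glue

variable {u v u' v' : ℝ → ℝ} {x : ℝ}

theorem glue_of_pos (hx : 0 < x) : glue u v x = u x := if_neg hx.not_ge

theorem glue_of_nonpos (hx : x ≤ 0) : glue u v x = v x := if_pos hx

theorem glue_eventuallyEq_of_pos (hx : 0 < x) : glue u v =ᶠ[𝓝 x] u := by
  filter_upwards [lt_mem_nhds hx] with t ht using glue_of_pos ht

theorem glue_eventuallyEq_of_neg (hx : x < 0) : glue u v =ᶠ[𝓝 x] v := by
  filter_upwards [gt_mem_nhds hx] with t ht using glue_of_nonpos (le_of_lt ht)

theorem continuous_glue (hu : Continuous u) (hv : Continuous v) (h : u 0 = v 0) :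
    Continuous (glue u v) :=
  hv.if_le hu continuous_id continuous_const (by rintro x rfl; exact h.symm)

theorem hasDerivAt_glue (hu : ∀ x, HasDerivAt u (u' x) x) (hv : ∀ x, HasDerivAt v (v' x) x)
    (hx : x ≠ 0) : HasDerivAt (glue u v) (glue u' v' x) x := by
  rcases lt_or_gt_of_ne hx with h | h
  · rw [glue_of_nonpos h.le]
    exact (hv x).congr_of_eventuallyEq (glue_eventuallyEq_of_neg h)
  · rw [glue_of_pos h]
    exact (hu x).congr_of_eventuallyEq (glue_eventuallyEq_of_pos h)

theorem Continuous.memLp_two_Ioo (hu : Continuous u) :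
    MemLp u 2 (volume.restrict (Ioo (-1 : ℝ) 1)) := by
  obtain ⟨C, hC⟩ := (isCompact_Icc (a := (-1 : ℝ)) (b := 1)).exists_bound_of_continuousOn
    hu.continuousOn
  refine MemLp.of_bound hu.aestronglyMeasurable C ?_
  exact (ae_restrict_mem measurableSet_Ioo).mono fun x hx => hC x (Ioo_subset_Icc_self hx)

theorem memLp_glue (hu : Continuous u) (hv : Continuous v) :
    MemLp (glue u v) 2 (volume.restrict (Ioo (-1) 1)) := by
  have h := MemLp.piecewise (s := Iic 0) measurableSet_Iic
    (hv.memLp_two_Ioo.mono_measure Measure.restrict_le_self)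
    (hu.memLp_two_Ioo.mono_measure Measure.restrict_le_self)
  refine h.ae_eq (Eventually.of_forall fun x => ?_)
  by_cases hx : x ≤ 0 <;> simp [glue, hx]

end glue

/-- `u` and `v` are the states of solutions of the normal-mode equation in the upper and the lower
fluid, subject to the boundary conditions and to the interface conditions with source `τ`. -/
structure IsTransmission (ρp ρm μp μm B ξ lam τ : ℝ) (u v : ℝ → Fin 4 → ℝ) : Prop where
  upper : IsStateOn (coeffZero ρp μp B ξ lam) (coeffTwo ρp μp B ξ lam) univ u
  lower : IsStateOn (coeffZero ρm μm B ξ lam) (coeffTwo ρm μm B ξ lam) univ v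
  jump_zero : u 0 0 = v 0 0
  jump_one : u 0 1 = v 0 1
  jump_moment : moment μp B ξ lam (u 0) = moment μm B ξ lam (v 0)
  jump_shear : shear ρm μm B ξ lam (v 0) - shear ρp μp B ξ lam (u 0) = τ
  right_zero : u 1 0 = 0
  right_one : u 1 1 = 0
  left_zero : v (-1) 0 = 0
  left_one : v (-1) 1 = 0

/-- The `i`-th component of the glued state. -/
noncomputable def glueState (u v : ℝ → Fin 4 → ℝ) (i : Fin 4) : ℝ → ℝ :=
  glue (fun x => u x i) (fun x => v x i)

theorem glueState_of_pos {u v : ℝ → Fin 4 → ℝ} (i : Fin 4) {x : ℝ} (hx : 0 < x) :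
    glueState u v i x = u x i := glue_of_pos hx

theorem glueState_of_nonpos {u v : ℝ → Fin 4 → ℝ} (i : Fin 4) {x : ℝ} (hx : x ≤ 0) :
    glueState u v i x = v x i := glue_of_nonpos hx

namespace IsTransmission

variable {ρp ρm μp μm B ξ lam τ : ℝ} {u v : ℝ → Fin 4 → ℝ}

/-- Continuity of the value and of the slope across the interface is all that `H²` asks for; the
second derivative may jump and is still square integrable. -/
theorem isH20 (h : IsTransmission ρp ρm μp μm B ξ lam τ u v) :
    IsH20 (glueState u v 0) (glueState u v 1) (glueState u v 2) where
  fst := IsH10.of_hasDerivAt_off_zero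
    (continuous_glue (h.upper.continuous 0) (h.lower.continuous 0) h.jump_zero).continuousOn
    (fun x hx => hasDerivAt_glue (fun x => h.upper.hasDerivAt_zero x (mem_univ x))
      (fun x => h.lower.hasDerivAt_zero x (mem_univ x)) hx.2)
    (memLp_glue (h.upper.continuous 1) (h.lower.continuous 1))
    ((glue_of_nonpos (by norm_num)).trans h.left_zero)
    ((glue_of_pos (by norm_num)).trans h.right_zero)
  snd := IsH10.of_hasDerivAt_off_zero
    (continuous_glue (h.upper.continuous 1) (h.lower.continuous 1) h.jump_one).continuousOn
    (fun x hx => hasDerivAt_glue (fun x => h.upper.hasDerivAt_one x (mem_univ x))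
      (fun x => h.lower.hasDerivAt_one x (mem_univ x)) hx.2)
    (memLp_glue (h.upper.continuous 2) (h.lower.continuous 2))
    ((glue_of_nonpos (by norm_num)).trans h.left_one)
    ((glue_of_pos (by norm_num)).trans h.right_one)

theorem glueState_zero_zero (h : IsTransmission ρp ρm μp μm B ξ lam τ u v) :
    glueState u v 0 0 = u 0 0 :=
  (glue_of_nonpos le_rfl).trans h.jump_zero.symm

/-- The weak formulation of the transmission problem. -/
theorem energyForm_eq (h : IsTransmission ρp ρm μp μm B ξ lam τ u v) (hμp : 0 < μp)
    (hμm : 0 < μm) (hl : 0 < lam) {φ φ' φ'' : ℝ → ℝ} (hφ : IsH20 φ φ' φ'') :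
    energyForm ρp ρm μp μm B ξ lam (glueState u v 0) (glueState u v 1) (glueState u v 2) φ φ' φ''
      = τ * φ 0 := by
  have hint := h.isH20.integrable_formDensity (ρp := ρp) (ρm := ρm) (μp := μp) (μm := μm)
    (B := B) (ξ := ξ) (lam := lam) hφ
  rw [← IntegrableOn, ← intervalIntegrable_iff_integrableOn_Ioo_of_le (by norm_num)] at hint
  have hl0 := hint.mono_set (c := -1) (d := 0) (by
    rw [uIcc_of_le (by norm_num), uIcc_of_le (by norm_num)]
    exact Icc_subset_Icc le_rfl (by norm_num))
  have hr0 := hint.mono_set (c := 0) (d := 1) (by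
    rw [uIcc_of_le (by norm_num), uIcc_of_le (by norm_num)]
    exact Icc_subset_Icc (by norm_num) le_rfl)
  unfold energyForm
  rw [← integral_Ioc_eq_integral_Ioo, ← intervalIntegral.integral_of_le (by norm_num),
    ← intervalIntegral.integral_add_adjacent_intervals hl0 hr0]
  have e1 : ∫ x in (-1 : ℝ)..0, formDensity (twoPhase ρp ρm x) (twoPhase μp μm x) B ξ lam
      (glueState u v 0 x) (glueState u v 1 x) (glueState u v 2 x) (φ x) (φ' x) (φ'' x) =
      ∫ x in (-1 : ℝ)..0, formDensity ρm μm B ξ lam (v x 0) (v x 1) (v x 2)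
        (φ x) (φ' x) (φ'' x) := by
    refine intervalIntegral.integral_congr_ae (Eventually.of_forall fun x hx => ?_)
    rw [uIoc_of_le (by norm_num)] at hx
    simp only [glueState, glue_of_nonpos hx.2, twoPhase, if_neg hx.2.not_gt]
  have e2 : ∫ x in (0 : ℝ)..1, formDensity (twoPhase ρp ρm x) (twoPhase μp μm x) B ξ lam
      (glueState u v 0 x) (glueState u v 1 x) (glueState u v 2 x) (φ x) (φ' x) (φ'' x) =
      ∫ x in (0 : ℝ)..1, formDensity ρp μp B ξ lam (u x 0) (u x 1) (u x 2)
        (φ x) (φ' x) (φ'' x) := by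
    refine intervalIntegral.integral_congr_ae (Eventually.of_forall fun x hx => ?_)
    rw [uIoc_of_le (by norm_num)] at hx
    simp only [glueState, glue_of_pos hx.1, twoPhase, if_pos hx.1]
  rw [e1, e2, h.lower.integral_formDensity (by positivity) hφ le_rfl (by norm_num) (by norm_num),
    h.upper.integral_formDensity (by positivity) hφ (by norm_num) (by norm_num) le_rfl,
    hφ.fst.left_eq_zero, hφ.fst.right_eq_zero, hφ.snd.left_eq_zero, hφ.snd.right_eq_zero,
    h.jump_moment, ← h.jump_shear]
  ring

/-- A transmission solution vanishes if its energy is bounded by the magnetic energy. -/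
theorem glueState_eq_zero (h : IsTransmission ρp ρm μp μm B ξ lam τ u v) (hρm : 0 < ρm)
    (hρ : ρm ≤ ρp) (hμp : 0 < μp) (hμm : 0 < μm) (hl : 0 < lam)
    (hle : τ * u 0 0 ≤ B ^ 2 * (ξ ^ 2 * (∫ x in Ioo (-1 : ℝ) 1, glueState u v 1 x ^ 2) +
      ∫ x in Ioo (-1 : ℝ) 1, glueState u v 2 x ^ 2)) {x : ℝ} (hx : x ∈ Icc (-1 : ℝ) 1) :
    glueState u v 0 x = 0 := by
  have h1 := h.isH20.le_energyForm (B := B) (ξ := ξ) hμp.le hμm.le hρm.le hρ hl.le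
  rw [h.energyForm_eq hμp hμm hl h.isH20, h.glueState_zero_zero] at h1
  refine h.isH20.fst.eq_zero_of_integral_sq_nonpos ?_ hx
  -- The magnetic energy on the two sides of `h1` and `hle` cancels, which leaves `lam² ρm ∫ |ψ'|² ≤
  -- 0`.
  have : 0 < lam ^ 2 * ρm := by positivity
  by_contra hcon
  rw [not_le] at hcon
  nlinarith [mul_pos this hcon]

end IsTransmission

/-! ### Normal modes are transmission solutions, and conversely -/

theorem ContDiffOn.hasDerivAt_iteratedDeriv {ψ : ℝ → ℝ} {s : Set ℝ} (hs : IsOpen s) {n : ℕ}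
    (h : ContDiffOn ℝ n ψ s) {k : ℕ} (hk : k < n) {x : ℝ} (hx : x ∈ s) :
    HasDerivAt (iteratedDeriv k ψ) (iteratedDeriv (k + 1) ψ x) x := by
  have h1 : DifferentiableAt ℝ (iteratedDeriv k ψ) x :=
    (((h.differentiableOn_iteratedDerivWithin (by exact_mod_cast hk) hs.uniqueDiffOn).congr
      fun y hy => (iteratedDerivWithin_of_isOpen hs hy).symm) x hx).differentiableAt
      (hs.mem_nhds hx)
  rw [iteratedDeriv_succ]
  exact h1.hasDerivAt

/-- The state `(ψ, ψ', ψ'', ψ''')` of a function. -/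
noncomputable def stateOf (ψ : ℝ → ℝ) (x : ℝ) : Fin 4 → ℝ :=
  ![ψ x, deriv ψ x, iteratedDeriv 2 ψ x, iteratedDeriv 3 ψ x]

/-- A solution of the normal-mode equation in one fluid extends to a solution on the line. -/
theorem exists_isStateOn_of_ode {ρ μ B ξ lam a b : ℝ} {ψ : ℝ → ℝ} (hab : a < b)
    (hpos : 0 < lam * μ + B ^ 2) (hψ : ContDiffOn ℝ 4 ψ (Ioo a b))
    (hode : ∀ x ∈ Ioo a b, -(lam ^ 2 * ρ * (|ξ| ^ 2 * ψ x - iteratedDeriv 2 ψ x)) =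
      μ * lam * (|ξ| ^ 4 * ψ x - 2 * |ξ| ^ 2 * iteratedDeriv 2 ψ x + iteratedDeriv 4 ψ x) +
      |B| ^ 2 * (-(|ξ| ^ 2 * iteratedDeriv 2 ψ x) + iteratedDeriv 4 ψ x)) :
    ∃ u : ℝ → Fin 4 → ℝ,
      IsStateOn (coeffZero ρ μ B ξ lam) (coeffTwo ρ μ B ξ lam) univ u ∧
      ∀ x ∈ Ioo a b, stateOf ψ x = u x := by
  have hd : ∀ k < 4, ∀ x ∈ Ioo a b,
      HasDerivAt (iteratedDeriv k ψ) (iteratedDeriv (k + 1) ψ x) x := fun k hk x hx =>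
    ContDiffOn.hasDerivAt_iteratedDeriv isOpen_Ioo (n := 4) (by exact_mod_cast hψ) hk hx
  have hstate : IsStateOn (coeffZero ρ μ B ξ lam) (coeffTwo ρ μ B ξ lam) (Ioo a b)
      (stateOf ψ) := by
    refine ⟨fun x hx => ?_, fun x hx => ?_, fun x hx => ?_, fun x hx => ?_⟩
    · simpa [stateOf] using hd 0 (by norm_num) x hx
    · simpa [stateOf] using hd 1 (by norm_num) x hx
    · simpa [stateOf] using hd 2 (by norm_num) x hx
    · have h3 := hd 3 (by norm_num) x hx
      have h4 : iteratedDeriv 4 ψ x = coeffZero ρ μ B ξ lam * ψ x +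
          coeffTwo ρ μ B ξ lam * iteratedDeriv 2 ψ x := by
        have h5 := hode x hx
        rw [show |ξ| ^ 4 = ξ ^ 4 from Even.pow_abs (by decide) ξ, sq_abs, sq_abs] at h5
        unfold coeffZero coeffTwo
        field_simp
        linear_combination -h5
      simp only [Nat.reduceAdd, h4] at h3
      simpa [stateOf] using h3
  obtain ⟨c, hc⟩ := hstate.exists_eq_stateFlow hab
  exact ⟨_, isStateOn_stateFlow _ _ c, hc⟩

theorem eq_of_tendsto_of_eqOn_right {F G : ℝ → ℝ} {a b l : ℝ} (hab : a < b) (hG : Continuous G)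
    (h : ∀ x ∈ Ioo a b, F x = G x) (hF : Tendsto F (𝓝[>] a) (𝓝 l)) : l = G a := by
  refine tendsto_nhds_unique hF ((hG.continuousWithinAt (s := Ioi a) (x := a)).tendsto.congr' ?_)
  filter_upwards [Ioo_mem_nhdsGT hab] with x hx using (h x hx).symm

theorem eq_of_tendsto_of_eqOn_left {F G : ℝ → ℝ} {a b l : ℝ} (hab : a < b) (hG : Continuous G)
    (h : ∀ x ∈ Ioo a b, F x = G x) (hF : Tendsto F (𝓝[<] b) (𝓝 l)) : l = G b := by
  refine tendsto_nhds_unique hF ((hG.continuousWithinAt (s := Iio b) (x := b)).tendsto.congr' ?_)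
  filter_upwards [Ioo_mem_nhdsLT hab] with x hx using (h x hx).symm

theorem HasJump.eq_sub {F G H : ℝ → ℝ} {j : ℝ} (h : HasJump F j) (hG : Continuous G)
    (hH : Continuous H) (hu : ∀ x ∈ Ioo (0 : ℝ) 1, F x = G x)
    (hl : ∀ x ∈ Ioo (-1 : ℝ) 0, F x = H x) : j = G 0 - H 0 := by
  obtain ⟨fp, fm, hp, hm, rfl⟩ := h
  rw [eq_of_tendsto_of_eqOn_right one_pos hG hu hp,
    eq_of_tendsto_of_eqOn_left (by norm_num) hH hl hm]

theorem hasJump_of_eqOn {F G H : ℝ → ℝ} {j : ℝ} (hG : Continuous G) (hH : Continuous H)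
    (hu : ∀ x, 0 < x → F x = G x) (hl : ∀ x, x < 0 → F x = H x) (hj : G 0 - H 0 = j) :
    HasJump F j := by
  refine ⟨G 0, H 0, (hG.continuousWithinAt (s := Ioi 0) (x := 0)).tendsto.congr' ?_,
    (hH.continuousWithinAt (s := Iio 0) (x := 0)).tendsto.congr' ?_, hj⟩
  · filter_upwards [self_mem_nhdsWithin] with x hx using (hu x hx).symm
  · filter_upwards [self_mem_nhdsWithin] with x hx using (hl x hx).symm

section correspondence

variable {g ρp ρm μp μm B ξ lam : ℝ}

/-- Every normal mode is a transmission solution with the buoyancy source. -/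
theorem IsNormalMode.exists_isTransmission {ψ : ℝ → ℝ}
    (h : IsNormalMode g ρp ρm μp μm B ξ ψ lam) (hμp : 0 < μp) (hμm : 0 < μm) (hl : 0 < lam) :
    ∃ u v : ℝ → Fin 4 → ℝ,
      IsTransmission ρp ρm μp μm B ξ lam (g * (ρp - ρm) * ξ ^ 2 * u 0 0) u v ∧
      ∀ x ∈ Icc (-1 : ℝ) 1, ψ x = glueState u v 0 x := by
  obtain ⟨u, hu, hψu⟩ := exists_isStateOn_of_ode (ρ := ρp) (μ := μp) (B := B) (ξ := ξ)
    (lam := lam) one_pos (by positivity) h.contDiffOn_upper (fun x hx => by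
      simpa only [twoPhase, if_pos hx.1] using h.ode x (Or.inr hx))
  obtain ⟨v, hv, hψv⟩ := exists_isStateOn_of_ode (ρ := ρm) (μ := μm) (B := B) (ξ := ξ)
    (lam := lam) (show (-1 : ℝ) < 0 by norm_num) (by positivity) h.contDiffOn_lower
    (fun x hx => by simpa only [twoPhase, if_neg hx.2.not_gt] using h.ode x (Or.inl hx))
  have u0 : ∀ x ∈ Ioo (0 : ℝ) 1, ψ x = u x 0 := fun x hx => by rw [← hψu x hx]; rfl
  have u1 : ∀ x ∈ Ioo (0 : ℝ) 1, deriv ψ x = u x 1 := fun x hx => by rw [← hψu x hx]; rfl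
  have u2 : ∀ x ∈ Ioo (0 : ℝ) 1, iteratedDeriv 2 ψ x = u x 2 := fun x hx => by
    rw [← hψu x hx]; rfl
  have u3 : ∀ x ∈ Ioo (0 : ℝ) 1, iteratedDeriv 3 ψ x = u x 3 := fun x hx => by
    rw [← hψu x hx]; rfl
  have v0 : ∀ x ∈ Ioo (-1 : ℝ) 0, ψ x = v x 0 := fun x hx => by rw [← hψv x hx]; rfl
  have v1 : ∀ x ∈ Ioo (-1 : ℝ) 0, deriv ψ x = v x 1 := fun x hx => by rw [← hψv x hx]; rfl
  have v2 : ∀ x ∈ Ioo (-1 : ℝ) 0, iteratedDeriv 2 ψ x = v x 2 := fun x hx => by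
    rw [← hψv x hx]; rfl
  have v3 : ∀ x ∈ Ioo (-1 : ℝ) 0, iteratedDeriv 3 ψ x = v x 3 := fun x hx => by
    rw [← hψv x hx]; rfl
  have cu := hu.continuous
  have cv := hv.continuous
  have hψ0u : ψ 0 = u 0 0 := eq_of_tendsto_of_eqOn_right one_pos (cu 0) u0
    (h.continuousAt_zero.tendsto.mono_left nhdsWithin_le_nhds)
  have hψ0v : ψ 0 = v 0 0 := eq_of_tendsto_of_eqOn_left (by norm_num) (cv 0) v0
    (h.continuousAt_zero.tendsto.mono_left nhdsWithin_le_nhds)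
  have r0 := eq_of_tendsto_of_eqOn_left one_pos (cu 0) u0 h.right_tendsto
  have r1 := eq_of_tendsto_of_eqOn_left one_pos (cu 1) u1 h.right_deriv_tendsto
  have l0 := eq_of_tendsto_of_eqOn_right (by norm_num) (cv 0) v0 h.left_tendsto
  have l1 := eq_of_tendsto_of_eqOn_right (by norm_num) (cv 1) v1 h.left_deriv_tendsto
  have j1 := h.jump_deriv.eq_sub (cu 1) (cv 1) u1 v1
  have c0 := cu 0
  have c1 := cu 1
  have c2 := cu 2
  have c3 := cu 3
  have d0 := cv 0
  have d1 := cv 1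
  have d2 := cv 2
  have d3 := cv 3
  have j2 := h.jump_second.eq_sub
    (G := fun x => μp * lam * (ξ ^ 2 * u x 0 + u x 2) + B ^ 2 * u x 2)
    (H := fun x => μm * lam * (ξ ^ 2 * v x 0 + v x 2) + B ^ 2 * v x 2)
    (by fun_prop) (by fun_prop)
    (fun x hx => by simp only [twoPhase, if_pos hx.1, sq_abs, u0 x hx, u2 x hx])
    (fun x hx => by simp only [twoPhase, if_neg hx.2.not_gt, sq_abs, v0 x hx, v2 x hx])
  obtain ⟨j, hj, hj3⟩ := h.jump_third
  have e1 := hj.eq_sub (G := fun x => lam ^ 2 * ρp * u x 1) (H := fun x => lam ^ 2 * ρm * v x 1)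
    (by fun_prop) (by fun_prop)
    (fun x hx => by simp only [twoPhase, if_pos hx.1, u1 x hx])
    (fun x hx => by simp only [twoPhase, if_neg hx.2.not_gt, v1 x hx])
  have e2 := hj3.eq_sub
    (G := fun x => μp * lam * (u x 3 - 3 * ξ ^ 2 * u x 1) + B ^ 2 * u x 3)
    (H := fun x => μm * lam * (v x 3 - 3 * ξ ^ 2 * v x 1) + B ^ 2 * v x 3)
    (by fun_prop) (by fun_prop)
    (fun x hx => by simp only [twoPhase, if_pos hx.1, sq_abs, u1 x hx, u3 x hx])
    (fun x hx => by simp only [twoPhase, if_neg hx.2.not_gt, sq_abs, v1 x hx, v3 x hx])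
  simp only [sq_abs] at e2
  refine ⟨u, v, ⟨hu, hv, hψ0u.symm.trans hψ0v, by linarith, ?_, ?_, r0.symm, r1.symm, l0.symm,
    l1.symm⟩, ?_⟩
  · unfold moment
    linear_combination -j2
  · rw [← hψ0u]
    unfold shear
    -- `shear` contains the magnetic term `B² ξ² ψ'`, which the jump condition lacks; it drops out
    -- since the slope does not jump. The converse direction uses the same cancellation.
    linear_combination e1 - e2 + B ^ 2 * ξ ^ 2 * j1
  · intro x hx
    rcases eq_or_lt_of_le hx.1 with rfl | h1
    · exact h.left_eq_zero.trans (l0.trans (glueState_of_nonpos 0 (by norm_num)).symm)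
    rcases eq_or_lt_of_le hx.2 with rfl | h2
    · exact h.right_eq_zero.trans (r0.trans (glueState_of_pos 0 (by norm_num)).symm)
    rcases lt_trichotomy x 0 with h3 | rfl | h3
    · exact (v0 x ⟨h1, h3⟩).trans (glueState_of_nonpos 0 h3.le).symm
    · exact hψ0v.trans (glueState_of_nonpos 0 le_rfl).symm
    · exact (u0 x ⟨h3, h2⟩).trans (glueState_of_pos 0 h3).symm

section converse

variable {τ : ℝ} {u v : ℝ → Fin 4 → ℝ}

theorem IsTransmission.contDiffOn_upper (h : IsTransmission ρp ρm μp μm B ξ lam τ u v) :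
    ContDiffOn ℝ ∞ (glueState u v 0) (Ioo 0 1) :=
  (h.upper.contDiff 0).contDiffOn.congr fun _ hx => glue_of_pos hx.1

theorem IsTransmission.contDiffOn_lower (h : IsTransmission ρp ρm μp μm B ξ lam τ u v) :
    ContDiffOn ℝ ∞ (glueState u v 0) (Ioo (-1) 0) :=
  (h.lower.contDiff 0).contDiffOn.congr fun _ hx => glue_of_nonpos hx.2.le

/-- A transmission solution with the buoyancy source is a normal mode. -/
theorem IsTransmission.isNormalMode (h : IsTransmission ρp ρm μp μm B ξ lam τ u v)
    (hμp : 0 < μp) (hμm : 0 < μm) (hl : 0 < lam) (hτ : τ = g * (ρp - ρm) * ξ ^ 2 * u 0 0) :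
    IsNormalMode g ρp ρm μp μm B ξ (glueState u v 0) lam := by
  set ψ := glueState u v 0 with hψ
  have cu := h.upper.continuous
  have cv := h.lower.continuous
  have eu : ∀ x, 0 < x → ψ =ᶠ[𝓝 x] fun t => u t 0 := fun x hx => glue_eventuallyEq_of_pos hx
  have ev : ∀ x, x < 0 → ψ =ᶠ[𝓝 x] fun t => v t 0 := fun x hx => glue_eventuallyEq_of_neg hx
  have u0 : ∀ x, 0 < x → ψ x = u x 0 := fun x hx => (eu x hx).eq_of_nhds
  have v0 : ∀ x, x < 0 → ψ x = v x 0 := fun x hx => (ev x hx).eq_of_nhds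
  have u1 : ∀ x, 0 < x → deriv ψ x = u x 1 := fun x hx => by
    rw [(eu x hx).deriv_eq, h.upper.deriv_eq]
  have v1 : ∀ x, x < 0 → deriv ψ x = v x 1 := fun x hx => by
    rw [(ev x hx).deriv_eq, h.lower.deriv_eq]
  have u2 : ∀ x, 0 < x → iteratedDeriv 2 ψ x = u x 2 := fun x hx => by
    rw [(eu x hx).iteratedDeriv_eq, h.upper.iteratedDeriv_two]
  have v2 : ∀ x, x < 0 → iteratedDeriv 2 ψ x = v x 2 := fun x hx => by
    rw [(ev x hx).iteratedDeriv_eq, h.lower.iteratedDeriv_two]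
  have u3 : ∀ x, 0 < x → iteratedDeriv 3 ψ x = u x 3 := fun x hx => by
    rw [(eu x hx).iteratedDeriv_eq, h.upper.iteratedDeriv_three]
  have v3 : ∀ x, x < 0 → iteratedDeriv 3 ψ x = v x 3 := fun x hx => by
    rw [(ev x hx).iteratedDeriv_eq, h.lower.iteratedDeriv_three]
  have u4 : ∀ x, 0 < x → iteratedDeriv 4 ψ x =
      coeffZero ρp μp B ξ lam * u x 0 + coeffTwo ρp μp B ξ lam * u x 2 := fun x hx => by
    rw [(eu x hx).iteratedDeriv_eq, h.upper.iteratedDeriv_four]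
  have v4 : ∀ x, x < 0 → iteratedDeriv 4 ψ x =
      coeffZero ρm μm B ξ lam * v x 0 + coeffTwo ρm μm B ξ lam * v x 2 := fun x hx => by
    rw [(ev x hx).iteratedDeriv_eq, h.lower.iteratedDeriv_four]
  have hψ0 : ψ 0 = u 0 0 := h.glueState_zero_zero
  have hcont : Continuous ψ := continuous_glue (cu 0) (cv 0) h.jump_zero
  have hξ4 : |ξ| ^ 4 = ξ ^ 4 := Even.pow_abs (by decide) ξ
  have hp : lam * μp + B ^ 2 ≠ 0 := by positivity
  have hm : lam * μm + B ^ 2 ≠ 0 := by positivity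
  have c0 := cu 0
  have c1 := cu 1
  have c2 := cu 2
  have c3 := cu 3
  have d0 := cv 0
  have d1 := cv 1
  have d2 := cv 2
  have d3 := cv 3
  have hleft : ψ (-1) = 0 := (glue_of_nonpos (by norm_num)).trans h.left_zero
  have hright : ψ 1 = 0 := (glue_of_pos (by norm_num)).trans h.right_zero
  refine ⟨h.contDiffOn_lower.of_le ENat.LEInfty.out,
    h.contDiffOn_upper.of_le ENat.LEInfty.out, ?_, hcont.continuousAt,
    hasJump_of_eqOn c1 d1 u1 v1 (sub_eq_zero.2 h.jump_one), ?_, ?_, hleft, hright,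
    hleft ▸ (hcont.continuousWithinAt).tendsto, hright ▸ (hcont.continuousWithinAt).tendsto,
    ?_, ?_⟩
  · rintro x (hx | hx)
    · simp only [twoPhase, if_neg hx.2.not_gt, sq_abs, hξ4, v0 x hx.2, v2 x hx.2, v4 x hx.2]
      unfold coeffZero coeffTwo
      field_simp
      ring
    · simp only [twoPhase, if_pos hx.1, sq_abs, hξ4, u0 x hx.1, u2 x hx.1, u4 x hx.1]
      unfold coeffZero coeffTwo
      field_simp
      ring
  · refine hasJump_of_eqOn (G := fun x => μp * lam * (ξ ^ 2 * u x 0 + u x 2) + B ^ 2 * u x 2)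
      (H := fun x => μm * lam * (ξ ^ 2 * v x 0 + v x 2) + B ^ 2 * v x 2)
      (by fun_prop) (by fun_prop)
      (fun x hx => by simp only [twoPhase, if_pos hx, sq_abs, u0 x hx, u2 x hx])
      (fun x hx => by simp only [twoPhase, if_neg hx.not_gt, sq_abs, v0 x hx, v2 x hx]) ?_
    have := h.jump_moment
    unfold moment at this
    linear_combination this
  · refine ⟨lam ^ 2 * ρp * u 0 1 - lam ^ 2 * ρm * v 0 1,
      hasJump_of_eqOn (G := fun x => lam ^ 2 * ρp * u x 1) (H := fun x => lam ^ 2 * ρm * v x 1)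
      (by fun_prop) (by fun_prop) (fun x hx => by simp only [twoPhase, if_pos hx, u1 x hx])
      (fun x hx => by simp only [twoPhase, if_neg hx.not_gt, v1 x hx]) rfl,
      hasJump_of_eqOn (G := fun x => μp * lam * (u x 3 - 3 * ξ ^ 2 * u x 1) + B ^ 2 * u x 3)
      (H := fun x => μm * lam * (v x 3 - 3 * ξ ^ 2 * v x 1) + B ^ 2 * v x 3)
      (by fun_prop) (by fun_prop)
      (fun x hx => by simp only [twoPhase, if_pos hx, sq_abs, u1 x hx, u3 x hx])
      (fun x hx => by simp only [twoPhase, if_neg hx.not_gt, sq_abs, v1 x hx, v3 x hx]) ?_⟩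
    have h1 := h.jump_shear
    have h2 := h.jump_one
    unfold shear at h1
    rw [hτ] at h1
    rw [sq_abs, hψ0]
    linear_combination h1 + B ^ 2 * ξ ^ 2 * h2
  · refine Tendsto.congr' ?_ (h.left_one ▸ (d1.continuousWithinAt (s := Ioi (-1))).tendsto)
    filter_upwards [Ioo_mem_nhdsGT (show (-1 : ℝ) < 0 by norm_num)] with x hx
      using (v1 x hx.2).symm
  · refine Tendsto.congr' ?_ (h.right_one ▸ (c1.continuousWithinAt (s := Iio 1)).tendsto)
    filter_upwards [Ioo_mem_nhdsLT (show (0 : ℝ) < 1 by norm_num)] with x hx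
      using (u1 x hx.1).symm

end converse

end correspondence

/-! ### Solvability with a point source at the interface -/

section source

variable {ρp ρm μp μm B ξ lam : ℝ}

/-- A transmission solution without energy has no source. -/
theorem IsTransmission.eq_zero_of_nonpos {τ : ℝ} {u v : ℝ → Fin 4 → ℝ}
    (h : IsTransmission ρp ρm μp μm B ξ lam τ u v) (hρm : 0 < ρm) (hρ : ρm ≤ ρp)
    (hμp : 0 < μp) (hμm : 0 < μm) (hl : 0 < lam) (hle : τ * u 0 0 ≤ 0) :
    u 0 = 0 ∧ v 0 = 0 := by
  have hz : ∀ x ∈ Icc (-1 : ℝ) 1, glueState u v 0 x = 0 := fun x hx =>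
    h.glueState_eq_zero hρm hρ hμp hμm hl (hle.trans (by
      have h1 : 0 ≤ ∫ x in Ioo (-1 : ℝ) 1, glueState u v 1 x ^ 2 :=
        integral_nonneg fun x => sq_nonneg _
      have h2 : 0 ≤ ∫ x in Ioo (-1 : ℝ) 1, glueState u v 2 x ^ 2 :=
        integral_nonneg fun x => sq_nonneg _
      positivity)) hx
  constructor
  · refine h.upper.eq_zero_of_eqOn (a := 0) (b := 1) one_pos (fun x hx => ?_) (by norm_num)
    rw [← glueState_of_pos (u := u) (v := v) 0 hx.1]
    exact hz x ⟨by linarith [hx.1], hx.2.le⟩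
  · refine h.lower.eq_zero_of_eqOn (a := -1) (b := 0) (by norm_num) (fun x hx => ?_)
      (by norm_num)
    rw [← glueState_of_nonpos (u := u) (v := v) 0 hx.2.le]
    exact hz x ⟨hx.1.le, by linarith [hx.2]⟩

/-- The boundary and interface conditions as a linear map of the two states at `0`. -/
noncomputable def interfaceMap (ρp ρm μp μm B ξ lam : ℝ) :
    (Fin 4 → ℝ) × (Fin 4 → ℝ) →ₗ[ℝ] (Fin 4 → ℝ) × (Fin 4 → ℝ) where
  toFun p := (![stateFlow (coeffZero ρp μp B ξ lam) (coeffTwo ρp μp B ξ lam) 1 p.1 0,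
      stateFlow (coeffZero ρp μp B ξ lam) (coeffTwo ρp μp B ξ lam) 1 p.1 1,
      stateFlow (coeffZero ρm μm B ξ lam) (coeffTwo ρm μm B ξ lam) (-1) p.2 0,
      stateFlow (coeffZero ρm μm B ξ lam) (coeffTwo ρm μm B ξ lam) (-1) p.2 1],
    ![p.1 0 - p.2 0, p.1 1 - p.2 1, moment μp B ξ lam p.1 - moment μm B ξ lam p.2,
      shear ρm μm B ξ lam p.2 - shear ρp μp B ξ lam p.1])
  map_add' p q := by
    ext i <;> fin_cases i <;> simp [moment, shear] <;> ring
  map_smul' c p := by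
    ext i <;> fin_cases i <;> simp [moment, shear] <;> ring

theorem isTransmission_of_interfaceMap {τ : ℝ} {p : (Fin 4 → ℝ) × (Fin 4 → ℝ)}
    (hp : interfaceMap ρp ρm μp μm B ξ lam p = (0, ![0, 0, 0, τ])) :
    IsTransmission ρp ρm μp μm B ξ lam τ
      (fun x => stateFlow (coeffZero ρp μp B ξ lam) (coeffTwo ρp μp B ξ lam) x p.1)
      (fun x => stateFlow (coeffZero ρm μm B ξ lam) (coeffTwo ρm μm B ξ lam) x p.2) := by
  have h1 := fun i => congrFun (congrArg Prod.fst hp) i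
  have h2 := fun i => congrFun (congrArg Prod.snd hp) i
  have a0 := h1 0
  have a1 := h1 1
  have a2 := h1 2
  have a3 := h1 3
  have b0 := h2 0
  have b1 := h2 1
  have b2 := h2 2
  have b3 := h2 3
  simp only [interfaceMap, LinearMap.coe_mk, AddHom.coe_mk] at a0 a1 a2 a3 b0 b1 b2 b3
  refine ⟨isStateOn_stateFlow _ _ _, isStateOn_stateFlow _ _ _, ?_, ?_, ?_, ?_, a0, a1, a2, a3⟩
  · simpa [stateFlow_zero, sub_eq_zero] using b0
  · simpa [stateFlow_zero, sub_eq_zero] using b1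
  · simpa [stateFlow_zero, sub_eq_zero] using b2
  · simpa [stateFlow_zero, sub_eq_zero] using b3

/-- The transmission problem with unit source is solvable. -/
theorem exists_isTransmission_one (hρm : 0 < ρm) (hρ : ρm ≤ ρp) (hμp : 0 < μp) (hμm : 0 < μm)
    (hl : 0 < lam) : ∃ u v, IsTransmission ρp ρm μp μm B ξ lam 1 u v := by
  -- Eight linear conditions on eight unknowns: uniqueness, which the energy provides, implies
  -- existence.
  have hinj : Function.Injective (interfaceMap ρp ρm μp μm B ξ lam) := by
    rw [← LinearMap.ker_eq_bot, LinearMap.ker_eq_bot']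
    intro p hp
    have h := isTransmission_of_interfaceMap (τ := 0) (p := p) (hp.trans (by
      ext i <;> fin_cases i <;> rfl))
    obtain ⟨h1, h2⟩ := h.eq_zero_of_nonpos hρm hρ hμp hμm hl (by simp)
    simp only [stateFlow_zero, one_apply_eq_self] at h1 h2
    exact Prod.ext h1 h2
  obtain ⟨p, hp⟩ := LinearMap.injective_iff_surjective.1 hinj (0, ![0, 0, 0, 1])
  exact ⟨_, _, isTransmission_of_interfaceMap hp⟩

end source

/-! ### The growth rate by the intermediate value theorem -/

/-- Near `y` the two monotonicities trap `m x` between `m y` and `y ^ 2 * m y / x ^ 2`, in an order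
that depends on the side, and both tend to `m y`. This spares any study of how the solution depends
on the parameter. -/
theorem continuousOn_of_antitoneOn_of_monotoneOn_sq_mul {m : ℝ → ℝ}
    (hanti : AntitoneOn m (Ioi 0)) (hmono : MonotoneOn (fun x => x ^ 2 * m x) (Ioi 0)) :
    ContinuousOn m (Ioi 0) := by
  intro y hy
  refine ContinuousAt.continuousWithinAt ?_
  have hy0 : 0 < y := hy
  have hr : Tendsto (fun x : ℝ => y ^ 2 * m y / x ^ 2) (𝓝 y) (𝓝 (m y)) := by
    have : ContinuousAt (fun x : ℝ => y ^ 2 * m y / x ^ 2) y := by fun_prop (disch := positivity)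
    have h2 := this.tendsto
    rwa [mul_div_cancel_left₀ _ (by positivity)] at h2
  have hmin := (tendsto_const_nhds (x := m y) (f := 𝓝 y)).min hr
  have hmax := (tendsto_const_nhds (x := m y) (f := 𝓝 y)).max hr
  rw [min_self] at hmin
  rw [max_self] at hmax
  refine tendsto_of_tendsto_of_tendsto_of_le_of_le' hmin hmax ?_ ?_
  · filter_upwards [lt_mem_nhds hy0] with x hx
    rcases le_total x y with h | h
    · exact (min_le_left _ _).trans (hanti hx hy h)
    · refine (min_le_right _ _).trans ?_
      rw [div_le_iff₀ (by positivity), mul_comm (m x)]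
      exact hmono hy hx h
  · filter_upwards [lt_mem_nhds hy0] with x hx
    rcases le_total x y with h | h
    · refine le_trans ?_ (le_max_right _ _)
      rw [le_div_iff₀ (by positivity), mul_comm (m x)]
      exact hmono hx hy h
    · exact (hanti hy hx h).trans (le_max_left _ _)

/-- If the gravitational energy `K φ(0)²` exceeds the magnetic energy for some `φ`, then for some
growth rate the response to a unit source at the interface equals `1 / K`. -/
theorem exists_isTransmission_of_magnetic_lt {ρp ρm μp μm B ξ K : ℝ} (hρm : 0 < ρm)
    (hρ : ρm ≤ ρp) (hμp : 0 < μp) (hμm : 0 < μm) (hK : 0 < K) {φ φ' φ'' : ℝ → ℝ}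
    (hφ : IsH20 φ φ' φ'')
    (hlt : B ^ 2 * (ξ ^ 2 * (∫ x in Ioo (-1 : ℝ) 1, φ' x ^ 2) +
      ∫ x in Ioo (-1 : ℝ) 1, φ'' x ^ 2) < K * φ 0 ^ 2) :
    ∃ lam > 0, ∃ u v, IsTransmission ρp ρm μp μm B ξ lam 1 u v ∧ K * u 0 0 = 1 := by
  have hρp : 0 ≤ ρp := hρm.le.trans hρ
  have hex : ∀ lam : ℝ, ∃ u v, 0 < lam → IsTransmission ρp ρm μp μm B ξ lam 1 u v := by
    -- For `lam ≤ 0` the states are set to zero; only positive rates matter.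
    intro lam
    by_cases hl : 0 < lam
    · obtain ⟨u, v, h⟩ := exists_isTransmission_one (B := B) (ξ := ξ) hρm hρ hμp hμm hl
      exact ⟨u, v, fun _ => h⟩
    · exact ⟨0, 0, fun h => absurd h hl⟩
  choose u v huv using hex
  set m : ℝ → ℝ := fun lam => u lam 0 0 with hm
  have hval : ∀ lam, 0 < lam → glueState (u lam) (v lam) 0 0 = m lam := fun lam hl =>
    (huv lam hl).glueState_zero_zero
  have hself : ∀ lam, 0 < lam → energyForm ρp ρm μp μm B ξ lam
      (glueState (u lam) (v lam) 0) (glueState (u lam) (v lam) 1) (glueState (u lam) (v lam) 2)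
      (glueState (u lam) (v lam) 0) (glueState (u lam) (v lam) 1) (glueState (u lam) (v lam) 2)
      = m lam := fun lam hl => by
    rw [(huv lam hl).energyForm_eq hμp hμm hl (huv lam hl).isH20, hval lam hl, one_mul]
  -- If `m lam ≤ 0`, the states vanish at the interface, against the unit jump of the shear.
  have hpos : ∀ lam, 0 < lam → 0 < m lam := by
    intro lam hl
    by_contra hcon
    obtain ⟨h1, h2⟩ := (huv lam hl).eq_zero_of_nonpos hρm hρ hμp hμm hl
      (by rw [one_mul]; exact not_lt.1 hcon)
    have := (huv lam hl).jump_shear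
    rw [h1, h2] at this
    simp [shear] at this
  -- Cauchy-Schwarz for the form, because `b 0` is the pairing of `b` with the response. The
  -- multiple `b 0 / m lam` of the response minimizes the energy of the difference.
  have hCS : ∀ lam, 0 < lam → ∀ b b' b'' : ℝ → ℝ, IsH20 b b' b'' →
      b 0 ^ 2 ≤ m lam * energyForm ρp ρm μp μm B ξ lam b b' b'' b b' b'' := by
    intro lam hl b b' b'' hb
    have h := (huv lam hl).isH20.energyForm_sub_nonneg (B := B) (ξ := ξ) hb hμp.le hμm.le hρp
      hρm.le hl.le (b 0 / m lam)
    rw [hself lam hl, (huv lam hl).energyForm_eq hμp hμm hl hb] at h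
    have hm0 := hpos lam hl
    have h2 := mul_nonneg hm0.le h
    have h3 : m lam * (energyForm ρp ρm μp μm B ξ lam b b' b'' b b' b'' -
        2 * (b 0 / m lam) * (1 * b 0) + (b 0 / m lam) ^ 2 * m lam) =
        m lam * energyForm ρp ρm μp μm B ξ lam b b' b'' b b' b'' - b 0 ^ 2 := by
      field_simp
      ring
    linarith
  -- Testing at rate `s` with the response `w_t`: `m(t)² ≤ m(s) E_s(w_t) ≤ m(s) E_t(w_t) = m(s)
  -- m(t)`. The next monotonicity exchanges the roles of `s` and `t` and uses that `E_λ/λ²`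
  -- decreases.
  have hanti : AntitoneOn m (Ioi 0) := by
    intro s hs t ht hst
    have hs0 : 0 < s := hs
    have ht0 : 0 < t := ht
    have h1 := hCS s hs0 _ _ _ (huv t ht0).isH20
    have h2 := (huv t ht0).isH20.energyForm_mono (B := B) (ξ := ξ) hμp.le hμm.le hρp hρm.le
      hs0.le hst
    rw [hself t ht0] at h2
    rw [hval t ht0] at h1
    have h3 := mul_le_mul_of_nonneg_left h2 (hpos s hs0).le
    have h4 : m t * m t ≤ m s * m t := by linarith [sq (m t)]
    exact le_of_mul_le_mul_right h4 (hpos t ht0)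
  have hmono : MonotoneOn (fun x => x ^ 2 * m x) (Ioi 0) := by
    intro s hs t ht hst
    have hs0 : 0 < s := hs
    have ht0 : 0 < t := ht
    have h1 := hCS t ht0 _ _ _ (huv s hs0).isH20
    have h2 := (huv s hs0).isH20.sq_mul_energyForm_le (ρp := ρp) (ρm := ρm) (B := B) (ξ := ξ)
      hμp.le hμm.le hs0.le hst
    rw [hself s hs0] at h2
    rw [hval s hs0] at h1
    have h3 := mul_le_mul_of_nonneg_left h1 (sq_nonneg s)
    have h4 := mul_le_mul_of_nonneg_left h2 (hpos t ht0).le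
    have h5 : (s ^ 2 * m s) * m s ≤ (t ^ 2 * m t) * m s := by nlinarith
    exact le_of_mul_le_mul_right h5 (hpos s hs0)
  have hcont := continuousOn_of_antitoneOn_of_monotoneOn_sq_mul hanti hmono
  obtain ⟨s, hs, hs1⟩ : ∃ s, 0 < s ∧ 1 < K * m s := by
    have hev := (hφ.tendsto_energyForm_zero (ρp := ρp) (ρm := ρm) (μp := μp) (μm := μm) (B := B)
      (ξ := ξ)).eventually_lt_const hlt
    obtain ⟨s, hsE, hs⟩ := ((hev.filter_mono nhdsWithin_le_nhds).and
      (self_mem_nhdsWithin (a := (0 : ℝ)) (s := Ioi 0))).exists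
    have hs0 : 0 < s := hs
    refine ⟨s, hs0, ?_⟩
    have h1 := hCS s hs0 _ _ _ hφ
    have h2 := mul_lt_mul_of_pos_left hsE (hpos s hs0)
    have h3 : 1 * φ 0 ^ 2 < (K * m s) * φ 0 ^ 2 := by linarith
    exact lt_of_mul_lt_mul_right h3 (sq_nonneg _)
  -- The kinetic energy alone is at least `t² ρm` times `2 m(t)²` by the trace inequality, while the
  -- whole energy is `m(t)`.
  have hlarge : ∀ t, 0 < t → 2 * t ^ 2 * ρm * m t ≤ 1 := by
    intro t ht
    have h1 := (huv t ht).isH20.le_energyForm (B := B) (ξ := ξ) hμp.le hμm.le hρm.le hρ ht.le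
    have h2 := (huv t ht).isH20.fst.two_mul_sq_le
    rw [hself t ht] at h1
    rw [hval t ht] at h2
    have h3 : 0 ≤ ∫ x in Ioo (-1 : ℝ) 1, glueState (u t) (v t) 1 x ^ 2 :=
      integral_nonneg fun x => sq_nonneg _
    have h4 : 0 ≤ ∫ x in Ioo (-1 : ℝ) 1, glueState (u t) (v t) 2 x ^ 2 :=
      integral_nonneg fun x => sq_nonneg _
    have h5 : 0 ≤ B ^ 2 * (ξ ^ 2 * (∫ x in Ioo (-1 : ℝ) 1, glueState (u t) (v t) 1 x ^ 2) +
      ∫ x in Ioo (-1 : ℝ) 1, glueState (u t) (v t) 2 x ^ 2) := by positivity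
    have h6 := mul_le_mul_of_nonneg_left h2 (show 0 ≤ t ^ 2 * ρm by positivity)
    have h7 : (2 * t ^ 2 * ρm * m t) * m t ≤ 1 * m t := by linarith [sq (m t)]
    exact le_of_mul_le_mul_right h7 (hpos t ht)
  obtain ⟨t, hst, ht1⟩ : ∃ t, s ≤ t ∧ K * m t < 1 := by
    -- From `1 ≤ t` and `K ≤ t ρm` follows `K ≤ t² ρm`, hence `K m(t) ≤ 1/2`.
    refine ⟨max s (max 1 (K / ρm)), le_max_left _ _, ?_⟩
    set t := max s (max 1 (K / ρm)) with ht
    have ha : 1 ≤ t := (le_max_left _ _).trans (le_max_right _ _)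
    have hb : K / ρm ≤ t := (le_max_right _ _).trans (le_max_right _ _)
    rw [div_le_iff₀ hρm] at hb
    have ht0 : 0 < t := by linarith
    have h1 := hlarge t ht0
    have h2 : K ≤ t ^ 2 * ρm := by nlinarith [mul_pos ht0 hρm]
    have h3 := mul_le_mul_of_nonneg_right h2 (hpos t ht0).le
    linarith
  obtain ⟨lam, hlam, hKlam⟩ := intermediate_value_Icc' hst
    (f := fun x => K * m x) (continuousOn_const.mul
      (hcont.mono fun x hx => hs.trans_le hx.1)) ⟨ht1.le, hs1.le⟩
  have hl0 : 0 < lam := hs.trans_le hlam.1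
  exact ⟨lam, hl0, u lam, v lam, huv lam hl0, hKlam⟩

/-! ### Smoothed tents: sharpness of the trace inequality in `H²₀` -/

theorem IsH20.of_contDiff {φ : ℝ → ℝ} (hφ : ContDiff ℝ 2 φ) (h1 : φ (-1) = 0) (h2 : φ 1 = 0)
    (h3 : deriv φ (-1) = 0) (h4 : deriv φ 1 = 0) : IsH20 φ (deriv φ) (deriv (deriv φ)) := by
  have hd : ContDiff ℝ 1 (deriv φ) := (contDiff_succ_iff_deriv (n := 1)).1 hφ |>.2.2
  exact ⟨IsH10.of_hasDerivAt_off_zero hφ.continuous.continuousOn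
      (fun x _ => (hφ.differentiable (by norm_num) x).hasDerivAt) hd.continuous.memLp_two_Ioo h1 h2,
    IsH10.of_hasDerivAt_off_zero hd.continuous.continuousOn
      (fun x _ => (hd.differentiable (by norm_num) x).hasDerivAt)
      (hd.continuous_deriv le_rfl).memLp_two_Ioo h3 h4⟩

/-- Smooth approximations in `H²₀` of the tent function, which is extremal for the trace
inequality. -/
theorem exists_isH20_near_tent (n : ℕ) : ∃ φ φ' φ'' : ℝ → ℝ, IsH20 φ φ' φ'' ∧
    1 - 2 / ((n : ℝ) + 1) ≤ φ 0 ∧ ∫ x in Ioo (-1 : ℝ) 1, φ' x ^ 2 ≤ 2 := by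
  set e : ℝ := 1 / ((n : ℝ) + 1) with he
  have he0 : 0 < e := by positivity
  have hp : ∀ x : ℝ, 0 < x ^ 2 + e ^ 2 := fun x => by positivity
  set s : ℝ := √(1 + e ^ 2) with hs
  have hs1 : 1 ≤ s := Real.one_le_sqrt.2 (by nlinarith)
  -- The root smooths `|x|`. The power is concentrated near `±1` and corrects the slope there: as `e
  -- * (n + 1) = 1`, its derivative is `x (x²)ⁿ / s`, which cancels `x / √(x² + e²)` at `±1`.
  set φ : ℝ → ℝ := fun x => s - √(x ^ 2 + e ^ 2) + e / (2 * s) * ((x ^ 2) ^ (n + 1) - 1) with hφ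
  have hC : ContDiff ℝ 2 φ := by
    have : ContDiff ℝ 2 fun x : ℝ => √(x ^ 2 + e ^ 2) :=
      ContDiff.sqrt (by fun_prop) fun x => (hp x).ne'
    fun_prop
  have hd : ∀ x, HasDerivAt φ (x * ((x ^ 2) ^ n / s - 1 / √(x ^ 2 + e ^ 2))) x := by
    intro x
    have h1 : HasDerivAt (fun x : ℝ => x ^ 2) (2 * x) x := by
      simpa using hasDerivAt_pow 2 x
    have h2 := (h1.add_const (e ^ 2)).sqrt (hp x).ne'
    have h3 := (((h1.fun_pow (n + 1)).sub_const 1).const_mul (e / (2 * s)))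
    refine ((h2.const_sub s).add h3).congr_deriv ?_
    have hen : e * ((n : ℝ) + 1) = 1 := by rw [he]; field_simp
    have hs0 : s ≠ 0 := by positivity
    rw [Nat.add_sub_cancel]
    push_cast
    calc -(2 * x / (2 * √(x ^ 2 + e ^ 2))) + e / (2 * s) * (((n : ℝ) + 1) * (x ^ 2) ^ n * (2 * x))
        = -(x / √(x ^ 2 + e ^ 2)) + e * ((n : ℝ) + 1) * (x * (x ^ 2) ^ n / s) := by
          rw [mul_div_mul_left _ _ two_ne_zero]
          field_simp
      _ = x * ((x ^ 2) ^ n / s - 1 / √(x ^ 2 + e ^ 2)) := by rw [hen]; ring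
  have hderiv : deriv φ = fun x => x * ((x ^ 2) ^ n / s - 1 / √(x ^ 2 + e ^ 2)) :=
    funext fun x => (hd x).deriv
  have hs0 : 0 < s := by linarith
  refine ⟨φ, deriv φ, deriv (deriv φ), IsH20.of_contDiff hC ?_ ?_ ?_ ?_, ?_, ?_⟩
  · simp [hφ, hs]
  · simp [hφ, hs]
  · simp [hderiv, hs]
  · simp [hderiv, hs]
  · have h1 : φ 0 = s - e - e / (2 * s) := by
      simp [hφ, Real.sqrt_sq he0.le]; ring
    have h2 : e / (2 * s) ≤ e := div_le_self he0.le (by linarith)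
    have h3 : 2 / ((n : ℝ) + 1) = 2 * e := by rw [he]; ring
    rw [h1, h3]
    linarith
  · have hbound : ∀ x ∈ Ioo (-1 : ℝ) 1, deriv φ x ^ 2 ≤ 1 := by
      intro x hx
      rw [hderiv]
      have hx2 : x ^ 2 ≤ 1 := by nlinarith [hx.1, hx.2]
      have ha0 : 0 ≤ (x ^ 2) ^ n / s := by positivity
      have ha1 : (x ^ 2) ^ n / s ≤ 1 :=
        div_le_one_of_le₀ ((pow_le_one₀ (sq_nonneg x) hx2).trans hs1) hs0.le
      have hb0 : 0 ≤ 1 / √(x ^ 2 + e ^ 2) := by positivity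
      have hb1 : x ^ 2 * (1 / √(x ^ 2 + e ^ 2)) ^ 2 ≤ 1 := by
        rw [div_pow, Real.sq_sqrt (hp x).le, one_pow, mul_one_div]
        exact div_le_one_of_le₀ (by nlinarith) (hp x).le
      set α := (x ^ 2) ^ n / s
      set β := 1 / √(x ^ 2 + e ^ 2)
      -- A difference of two nonnegative numbers is no larger than the greater one, so the
      -- correction does not raise the slope above `1`.
      have hkey : (α - β) ^ 2 ≤ max (α ^ 2) (β ^ 2) := by
        rcases le_total α β with h | h
        · exact (by nlinarith : (α - β) ^ 2 ≤ β ^ 2).trans (le_max_right _ _)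
        · exact (by nlinarith : (α - β) ^ 2 ≤ α ^ 2).trans (le_max_left _ _)
      have ha2 : x ^ 2 * α ^ 2 ≤ 1 := by
        have : α ^ 2 ≤ 1 := by nlinarith
        nlinarith [sq_nonneg x, sq_nonneg α]
      calc (x * (α - β)) ^ 2 = x ^ 2 * (α - β) ^ 2 := by ring
        _ ≤ x ^ 2 * max (α ^ 2) (β ^ 2) := mul_le_mul_of_nonneg_left hkey (sq_nonneg x)
        _ ≤ 1 := by
          rcases max_choice (α ^ 2) (β ^ 2) with h | h <;> rw [h] <;> assumption
    have hcd : Continuous (deriv φ) := hC.continuous_deriv (by norm_num)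
    calc ∫ x in Ioo (-1 : ℝ) 1, deriv φ x ^ 2 ≤ ∫ x in Ioo (-1 : ℝ) 1, (1 : ℝ) :=
          setIntegral_mono_on hcd.memLp_two_Ioo.integrable_sq (by simp) measurableSet_Ioo hbound
      _ = 2 := by norm_num

/-- Below half of the gravitational constant, some `H²₀` function has gravitational energy larger
than its magnetic tension. -/
theorem exists_isH20_tension_lt {G b : ℝ} (hb : 0 ≤ b) (hG : 2 * b < G) :
    ∃ φ φ' φ'' : ℝ → ℝ, IsH20 φ φ' φ'' ∧
      0 < G * φ 0 ^ 2 - b * ∫ x in Ioo (-1 : ℝ) 1, φ' x ^ 2 := by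
  have ht : Tendsto (fun n : ℕ => G * (1 - 2 * (1 / ((n : ℝ) + 1))) ^ 2) atTop (𝓝 G) := by
    have h := ((tendsto_one_div_add_atTop_nhds_zero_nat (𝕜 := ℝ)).const_mul 2).const_sub 1
    simpa using (h.pow 2).const_mul G
  -- `1 ≤ n` makes `1 - 2 / (n + 1)` nonnegative, so the lower bound for `φ 0` can be squared.
  obtain ⟨n, hn, hn1⟩ := ((ht.eventually_const_lt hG).and (eventually_ge_atTop 1)).exists
  obtain ⟨φ, φ', φ'', hφ, h0, hI⟩ := exists_isH20_near_tent n
  refine ⟨φ, φ', φ'', hφ, ?_⟩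
  have hn2 : (1 : ℝ) ≤ n := by exact_mod_cast hn1
  have h1 : 2 / ((n : ℝ) + 1) ≤ 1 := by rw [div_le_one (by positivity)]; linarith
  rw [mul_one_div] at hn
  have h2 : (1 - 2 / ((n : ℝ) + 1)) ^ 2 ≤ φ 0 ^ 2 := by
    have : 0 ≤ 1 - 2 / ((n : ℝ) + 1) := by linarith
    gcongr
  have hG0 : 0 ≤ G := by linarith
  have h3 := mul_le_mul_of_nonneg_left h2 hG0
  have h4 := mul_le_mul_of_nonneg_left hI hb
  linarith

/-! ### Critical numbers and the conclusion -/

/-- The frequency enters the problem only through `|ξ|`, so a mode selected for `|ξ|` serves both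
signs and the selection is even. -/
theorem IsNormalMode.of_abs {g ρp ρm μp μm B ξ lam : ℝ} {ψ : ℝ → ℝ}
    (h : IsNormalMode g ρp ρm μp μm B |ξ| ψ lam) : IsNormalMode g ρp ρm μp μm B ξ ψ lam := by
  obtain ⟨h1, h2, h3, h4, h5, h6, h7, h8, h9, h10, h11, h12, h13⟩ := h
  simp only [abs_abs] at h3 h6 h7
  exact ⟨h1, h2, h3, h4, h5, h6, h7, h8, h9, h10, h11, h12, h13⟩

/-- The quotients defining the critical magnetic number are bounded by `g[ρ] / 2`. -/
theorem quotient_le_half {G : ℝ} (hG : 0 ≤ G) {ψ ψ' : ℝ → ℝ} (h : IsH10 ψ ψ')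
    (hpos : 0 < ∫ x in Ioo (-1 : ℝ) 1, ψ' x ^ 2) :
    G * ψ 0 ^ 2 / ∫ x in Ioo (-1 : ℝ) 1, ψ' x ^ 2 ≤ G / 2 := by
  rw [div_le_div_iff₀ hpos two_pos]
  nlinarith [mul_le_mul_of_nonneg_left h.two_mul_sq_le hG]

theorem theorem2p1 (g ρp ρm μp μm B : ℝ) (hg : 0 < g) (hρm : 0 < ρm) (hρ : ρm < ρp)
    (hμp : 0 < μp) (hμm : 0 < μm) :
    (criticalMagneticNumber g ρp ρm ≤ |B| →
      ∀ (ξ lam : ℝ) (ψ : ℝ → ℝ), 0 < lam → IsNormalMode g ρp ρm μp μm B ξ ψ lam →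
        ∀ x ∈ Icc (-1 : ℝ) 1, ψ x = 0) ∧
    (|B| < criticalMagneticNumber g ρp ρm →
      ∀ ξ : ℝ, |ξ| ≤ verticalCriticalFrequency g ρp ρm B →
        ∀ (lam : ℝ) (ψ : ℝ → ℝ), 0 < lam → IsNormalMode g ρp ρm μp μm B ξ ψ lam →
          ∀ x ∈ Icc (-1 : ℝ) 1, ψ x = 0) ∧
    (|B| < criticalMagneticNumber g ρp ρm →
      ∃ (ψ : ℝ → ℝ → ℝ) (lam : ℝ → ℝ),
        ∀ ξ : ℝ, verticalCriticalFrequency g ρp ρm B < |ξ| →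
          0 < lam ξ ∧ IsNormalMode g ρp ρm μp μm B ξ (ψ ξ) (lam ξ) ∧
          ψ (-ξ) = ψ ξ ∧ lam (-ξ) = lam ξ ∧
          ContDiffOn ℝ ∞ (ψ ξ) (Ioo (-1) 0) ∧ ContDiffOn ℝ ∞ (ψ ξ) (Ioo 0 1) ∧
          ψ ξ 0 ≠ 0) := by
  have hG : 0 < g * (ρp - ρm) := mul_pos hg (sub_pos.2 hρ)
  refine ⟨?_, ?_, ?_⟩
  · intro hB ξ lam ψ hl hψ x hx
    obtain ⟨u, v, h, heq⟩ := hψ.exists_isTransmission hμp hμm hl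
    rw [heq x hx]
    have hH := h.isH20
    set I := ∫ x in Ioo (-1 : ℝ) 1, glueState u v 1 x ^ 2 with hI
    have hI0 : 0 ≤ I := integral_nonneg fun x => sq_nonneg _
    -- The quotients in the supremum require `0 < I`; for `I = 0` the mode vanishes at once.
    rcases hI0.eq_or_lt with hI1 | hI1
    · exact hH.fst.eq_zero_of_integral_sq_nonpos hI1.symm.le hx
    · refine h.glueState_eq_zero hρm hρ.le hμp hμm hl ?_ hx
      rw [criticalMagneticNumber, Real.sqrt_le_left (abs_nonneg B), sq_abs] at hB
      have hle : g * (ρp - ρm) * glueState u v 0 0 ^ 2 / I ≤ B ^ 2 := by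
        refine le_trans ?_ hB
        refine le_csSup ⟨g * (ρp - ρm) / 2, ?_⟩ ⟨_, _, hH.fst, hI1, rfl⟩
        rintro r ⟨φ, φ', hφ, hφ0, rfl⟩
        exact quotient_le_half hG.le hφ hφ0
      rw [div_le_iff₀ hI1, h.glueState_zero_zero] at hle
      have h2 : 0 ≤ ∫ x in Ioo (-1 : ℝ) 1, glueState u v 2 x ^ 2 :=
        integral_nonneg fun x => sq_nonneg _
      nlinarith [mul_le_mul_of_nonneg_left hle (sq_nonneg ξ), mul_nonneg (sq_nonneg B) h2]
  · intro _ ξ hξ lam ψ hl hψ x hx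
    obtain ⟨u, v, h, heq⟩ := hψ.exists_isTransmission hμp hμm hl
    rw [heq x hx]
    have hH := h.isH20
    refine h.glueState_eq_zero hρm hρ.le hμp hμm hl ?_ hx
    set I := ∫ x in Ioo (-1 : ℝ) 1, glueState u v 1 x ^ 2 with hI
    set J := ∫ x in Ioo (-1 : ℝ) 1, glueState u v 2 x ^ 2 with hJ
    have hJ0 : 0 ≤ J := integral_nonneg fun x => sq_nonneg _
    -- If the denominator is not positive, `ψ` is no competitor in the infimum, but then tension
    -- alone dominates gravity.
    rcases le_or_gt (g * (ρp - ρm) * glueState u v 0 0 ^ 2 - |B| ^ 2 * I) 0 with hD | hD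
    · rw [h.glueState_zero_zero, sq_abs] at hD
      nlinarith [mul_le_mul_of_nonneg_left hD (sq_nonneg ξ), mul_nonneg (sq_nonneg B) hJ0]
    · have hlow : ∀ r ∈ {r : ℝ | ∃ ψ ψ' ψ'' : ℝ → ℝ, IsH20 ψ ψ' ψ'' ∧
          0 < g * (ρp - ρm) * ψ 0 ^ 2 - |B| ^ 2 * ∫ x in Ioo (-1 : ℝ) 1, ψ' x ^ 2 ∧
          r = (|B| ^ 2 * ∫ x in Ioo (-1 : ℝ) 1, ψ'' x ^ 2) /
            (g * (ρp - ρm) * ψ 0 ^ 2 - |B| ^ 2 * ∫ x in Ioo (-1 : ℝ) 1, ψ' x ^ 2)}, 0 ≤ r := by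
        rintro r ⟨φ, φ', φ'', -, hφ0, rfl⟩
        exact div_nonneg (mul_nonneg (sq_nonneg _) (integral_nonneg fun x => sq_nonneg _)) hφ0.le
      rw [verticalCriticalFrequency, Real.le_sqrt (abs_nonneg ξ) (Real.sInf_nonneg hlow),
        sq_abs] at hξ
      have hle := hξ.trans (csInf_le ⟨0, hlow⟩ ⟨_, _, _, hH, hD, rfl⟩)
      rw [le_div_iff₀ hD, h.glueState_zero_zero, sq_abs] at hle
      linarith
  · intro hB
    have hB2 : 2 * |B| ^ 2 < g * (ρp - ρm) := by
      have h1 : criticalMagneticNumber g ρp ρm ≤ √(g * (ρp - ρm) / 2) := by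
        refine Real.sqrt_le_sqrt (Real.sSup_le ?_ (by positivity))
        rintro r ⟨φ, φ', hφ, hφ0, rfl⟩
        exact quotient_le_half hG.le hφ hφ0
      have h2 := (Real.lt_sqrt (abs_nonneg B)).1 (hB.trans_le h1)
      linarith
    have hex : ∀ r : ℝ, ∃ (ψ : ℝ → ℝ) (lam : ℝ), verticalCriticalFrequency g ρp ρm B < r →
        0 < lam ∧ IsNormalMode g ρp ρm μp μm B r ψ lam ∧
          ContDiffOn ℝ ∞ ψ (Ioo (-1) 0) ∧ ContDiffOn ℝ ∞ ψ (Ioo 0 1) ∧ ψ 0 ≠ 0 := by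
      intro r
      by_cases hr : verticalCriticalFrequency g ρp ρm B < r
      swap
      · exact ⟨0, 0, fun h => absurd h hr⟩
      have hr0 : 0 < r := (Real.sqrt_nonneg _).trans_lt hr
      have hr2 := (Real.sqrt_lt' hr0).1 hr
      -- The real `sInf` of the empty set is `0`, so a competitor is needed before the infimum can
      -- be approached.
      obtain ⟨φ₀, φ₀', φ₀'', hφ₀, hφ₀D⟩ := exists_isH20_tension_lt (sq_nonneg |B|) hB2
      obtain ⟨q, ⟨φ, φ', φ'', hφ, hD, rfl⟩, hq⟩ :=
        exists_lt_of_csInf_lt (by exact ⟨_, φ₀, φ₀', φ₀'', hφ₀, hφ₀D, rfl⟩) hr2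
      rw [div_lt_iff₀ hD, sq_abs] at hq
      obtain ⟨lam, hl, u, v, h, hK⟩ := exists_isTransmission_of_magnetic_lt (B := B) (ξ := r)
        (K := g * (ρp - ρm) * r ^ 2) hρm hρ.le hμp hμm (by positivity) hφ (by linarith)
      refine ⟨glueState u v 0, lam, fun _ => ⟨hl, h.isNormalMode hμp hμm hl hK.symm,
        h.contDiffOn_lower, h.contDiffOn_upper, ?_⟩⟩
      rw [h.glueState_zero_zero]
      rintro h0
      simp [h0] at hK
    choose Ψ Λ hΨ using hex
    refine ⟨fun ξ => Ψ |ξ|, fun ξ => Λ |ξ|, fun ξ hξ => ?_⟩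
    obtain ⟨h1, h2, h3, h4, h5⟩ := hΨ |ξ| hξ
    exact ⟨h1, h2.of_abs, by simp, by simp, h3, h4, h5⟩
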